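/- Let $[n]=\{1,\dots,n\}$, let $\Pi\subseteq 2^{[n]}$ be a family of sets and $\delta\in(0,1)$. For $\mu\in[-1,1]^n$ put $\mu_\pi=\sum_{i\in\pi}\mu_i$, and assume that $\pi^*=\operatorname{argmax}_{\pi\in\Pi}\mu_\pi$ is unique. Let $V(\mathcal A)$ be the VC dimension of a family $\mathcal A$, with the convention $V(\mathcal A)\ge 1$ (a VC dimension $0$ is replaced by $1$), let $B(k,\pi')=\{\pi\in\Pi:|\pi\Delta\pi'|=k\}$, and define $$V_{\pi,\pi'}=\min\bigl\{\max\{V(B(|\pi\Delta\pi'|,\pi)),V(B(|\pi\Delta\pi'|,\pi'))\},\,|\pi\Delta\pi'|\bigr\},$$ $$C(\pi,\pi',t,\delta)=\sqrt{\frac{8|\pi\Delta\pi'|\,nV_{\pi,\pi'}\log(n/\delta)}{t}}+\frac{4nV_{\pi,\pi'}\log(n/\delta)}{3t},$$ and, for $\pi\in\Pi\setminus\{\pi^*\}$, $$\widetilde\Delta_\pi=\frac{|\mu_\pi-\mu_{\pi^*}|}{|\pi\Delta\pi^*|},\qquad \tau_\pi=\frac{V_{\pi,\pi^*}}{|\pi\Delta\pi^*|}\,\frac1{\widetilde\Delta_\pi^{2}}\,\log\Bigl(\frac{n\max\{2,\log(\widetilde\Delta_\pi^{-2})\}}{\delta}\Bigr).$$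 **Algorithm.** Start with the active family $\mathcal A_1=\Pi$ and $k=1$; throughout, $T_k=\bigcup_{\pi\in\mathcal A_k}\pi\setminus\bigcap_{\pi\in\mathcal A_k}\pi$. For $t=1,2,\dots$: stop if $T_k=\emptyset$ (in the persistent-noise setting also stop if $t>n$). Otherwise draw an item $I_t$, and, only if $I_t\in T_k$, take one sample, that is, observe the reward $R_{I_t,t}$. Then, if $t=2^k$, remove from $\mathcal A_k$ every $\pi$ for which some $\pi'\in\mathcal A_k$ satisfies $\widehat\mu_{\pi'}-\widehat\mu_\pi>C(\pi',\pi,t,\delta_k)$, where $\delta_k=\delta/(2k^2)$ and $$\widehat\mu_{\pi'}-\widehat\mu_\pi=\frac nt\Bigl(\sum_{s\le t}R_{I_s,s}\mathbf 1\{I_s\in\pi'\setminus\pi\}-\sum_{s\le t}R_{I_s,s}\mathbf 1\{I_s\in\pi\setminus\pi'\}\Bigr)$$ (sums over the observed rewards); this gives $\mathcal A_{k+1}$, and $k$ is increased by one. When the algorithm stops, it outputs an active $\pi'$ with $\widehat\mu_{\pi'}-\widehat\mu_\pi\ge0$ for all active $\pi$, where the estimates use all draws made so far. In the *stochastic-noise*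 setting the $I_t$ are i.i.d. uniform on $[n]$, and for each $i$ the rewards $R_{i,t}\in[-1,1]$, $t\ge1$, are i.i.d. with mean $\mu_i$ (the draws and rewards of different times are independent, and $I_t$ is independent of the rewards at time $t$). In the *persistent-noise* setting the $I_t$ are drawn uniformly without replacement from $[n]$ and $R_{i,t}=\mu_i$. **Theorem.** There is a universal constant $c>0$ such that for all $n,\Pi,\mu,\delta$ as above: 1. in the stochastic-noise setting, with probability greater than $1-\delta$, the algorithm stops and returns $\pi^*$ after at most $c\sum_{i=1}^n\max_{\pi\in\Pi:\,i\in\pi\Delta\pi^*}\tau_\pi$ samples; 2. in the persistent-noise setting, with probability greater than $1-\delta$, it returns $\pi^*$ after at most $c\sum_{i=1}^n\min\{1,\max_{\pi\in\Pi:\,i\in\pi\Delta\pi^*}\tau_\pi\}$ samples. (A maximum over the empty set is $0$.) In particular, the same holds for active classification, where item $i$ has labels $Y_{i,t}\sim\mathrm{Ber}(\eta_i)$ (with $\eta_i\in\{0,1\}$ for persistent noise), the rewards are $R_{i,t}=2Y_{i,t}-1$, $\mu_i=2\eta_i-1$, and $\pi^*$ is the unique minimizer over $\Pi$ of the risk $\frac1n\bigl(\sum_{i\notin\pi}\eta_i+\sum_{i\in\pi}(1-\eta_i)\bigr)$.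 -/

import Mathlib

open MeasureTheory ProbabilityTheory

noncomputable section

namespace ActionElimination

variable {n : ℕ}

/-- `μ_π = ∑_{i ∈ π} μ_i`. -/
def setMean (μ : Fin n → ℝ) (π : Finset (Fin n)) : ℝ := ∑ i ∈ π, μ i

/-- The classification risk of `π`: the probability that the indicator of `π` disagrees with a
label `Y_i ∼ Ber(η_i)`, for `i` uniform in `[n]`. -/
def risk (η : Fin n → ℝ) (π : Finset (Fin n)) : ℝ :=
  (1 / (n : ℝ)) * (∑ i ∈ πᶜ, η i + ∑ i ∈ π, (1 - η i))

/-- `|π ∆ π'|`. -/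
def symmDist (π π' : Finset (Fin n)) : ℕ := (symmDiff π π').card

/-- `B₂(k, π') = {π ∈ F : |π ∆ π'| = k}`. -/
def sphere (F : Finset (Finset (Fin n))) (k : ℕ) (π' : Finset (Fin n)) :
    Finset (Finset (Fin n)) :=
  F.filter fun π => symmDist π π' = k

/-- The VC dimension, with the convention that it is at least one. -/
def vc (A : Finset (Finset (Fin n))) : ℕ := max 1 A.vcDim

/-- The local VC dimension
`V_{π,π'} = max {V(B₂(|π ∆ π'|, π)), V(B₂(|π ∆ π'|, π'))} ∧ |π ∆ π'|`. -/
def localVC (F : Finset (Finset (Fin n))) (π π' : Finset (Fin n)) : ℕ :=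
  min (max (vc (sphere F (symmDist π π') π)) (vc (sphere F (symmDist π π') π'))) (symmDist π π')

/-- The confidence width `C(π, π', t, δ)`. -/
def width (F : Finset (Finset (Fin n))) (π π' : Finset (Fin n)) (t : ℕ) (δ : ℝ) : ℝ :=
  Real.sqrt (8 * symmDist π π' * n * localVC F π π' * Real.log (n / δ) / t)
    + 4 * n * localVC F π π' * Real.log (n / δ) / (3 * t)

/-! ### The algorithm -/

/-- The set of items on which the members of `A` do not all agree: union minus intersection. -/
def disagreement (A : Finset (Finset (Fin n))) : Finset (Fin n) := A.sup id \ A.inf id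

/-- The memory of the algorithm: the round counter `k`, the active sets, and the list of all
observed (item, reward) pairs.  The length of that list is the number of samples used. -/
structure State (n : ℕ) where
  round : ℕ
  active : Finset (Finset (Fin n))
  obs : List (Fin n × ℝ)

/-- The estimate of `μ_{π'} - μ_π` after `t` draws, computed from the observed rewards. -/
def estimate (t : ℕ) (obs : List (Fin n × ℝ)) (π' π : Finset (Fin n)) : ℝ :=
  ((n : ℝ) / t) * ((obs.map fun x => if x.1 ∈ π' \ π then x.2 else 0).sum
    - (obs.map fun x => if x.1 ∈ π \ π' then x.2 else 0).sum)

/-- Removal of the active sets that are beaten by more than the confidence width. -/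
def eliminate (C : Finset (Fin n) → Finset (Fin n) → ℕ → ℝ → ℝ) (t : ℕ) (δ : ℝ)
    (A : Finset (Finset (Fin n))) (obs : List (Fin n × ℝ)) : Finset (Finset (Fin n)) :=
  open Classical in
  A.filter fun π => ¬ ∃ π' ∈ A, C π' π t δ < estimate t obs π' π

/-- Iteration number `t` of the loop: item `i` has been drawn; its reward `r` is observed only if
`i` is in the current disagreement set.  When `t = 2 ^ k` in round `k`, sets are eliminated at
level `δ_k = δ / (2 k ^ 2)` and the next round starts. -/
def step (C : Finset (Fin n) → Finset (Fin n) → ℕ → ℝ → ℝ) (δ : ℝ) (t : ℕ) (i : Fin n) (r : ℝ)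
    (S : State n) : State n :=
  let obs := if i ∈ disagreement S.active then (i, r) :: S.obs else S.obs
  if t = 2 ^ S.round then
    ⟨S.round + 1, eliminate C t (δ / (2 * (S.round : ℝ) ^ 2)) S.active obs, obs⟩
  else ⟨S.round, S.active, obs⟩

/-- The state after `t` iterations on the family `F`, where `I s` is the item drawn in iteration
`s + 1` and `R i s` is the reward that item `i` would give in it. -/
def run (F : Finset (Finset (Fin n))) (C : Finset (Fin n) → Finset (Fin n) → ℕ → ℝ → ℝ) (δ : ℝ)
    (I : ℕ → Fin n) (R : Fin n → ℕ → ℝ) : ℕ → State n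
  | 0 => ⟨1, F, []⟩
  | t + 1 => step C δ (t + 1) (I t) (R (I t) t) (run F C δ I R t)

/-- The stopping rule, checked after `t` iterations: no disagreement is left, or the maximal number
of iterations is exhausted (`⊤` for stochastic noise, `n` for persistent noise). -/
def Stops (horizon : ℕ∞) (t : ℕ) (S : State n) : Prop :=
  disagreement S.active = ∅ ∨ horizon ≤ t

/-- `π'` is a legitimate output after `t` iterations: active and with the best estimate. -/
def IsOutput (t : ℕ) (S : State n) (π' : Finset (Fin n)) : Prop :=
  π' ∈ S.active ∧ ∀ π ∈ S.active, 0 ≤ estimate t S.obs π' π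

/-- The algorithm, whose successive states are `traj`, stops after finitely many iterations; there
`πs` is its one and only possible output, and at most `b` samples have been used. -/
def ReturnsWithin (horizon : ℕ∞) (traj : ℕ → State n) (πs : Finset (Fin n)) (b : ℝ) : Prop :=
  ∃ t : ℕ, Stops horizon t (traj t) ∧ (∀ s < t, ¬ Stops horizon s (traj s)) ∧
    (∀ π', IsOutput t (traj t) π' ↔ π' = πs) ∧ ((traj t).obs.length : ℝ) ≤ b

/-! ### Sample complexity -/

/-- The normalized gap `|μ_π - μ_{πs}| / |π ∆ πs|`. -/
def gap (μ : Fin n → ℝ) (πs π : Finset (Fin n)) : ℝ :=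
  |setMean μ π - setMean μ πs| / symmDist π πs

/-- `τ_π`; the iterated logarithm `log (gap ^ (-2))` is truncated below at `2`. -/
def tau (F : Finset (Finset (Fin n))) (μ : Fin n → ℝ) (δ : ℝ) (πs π : Finset (Fin n)) : ℝ :=
  (localVC F π πs : ℝ) / symmDist πs π * (1 / gap μ πs π ^ 2)
    * Real.log (n * max 2 (Real.log (1 / gap μ πs π ^ 2)) / δ)

/-- `max_{π ∈ F : i ∈ π ∆ πs} τ_π`, which is `0` if there is no such `π`. -/
def maxTau (F : Finset (Finset (Fin n))) (μ : Fin n → ℝ) (δ : ℝ) (πs : Finset (Fin n))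
    (i : Fin n) : ℝ :=
  ⨆ π : {π : Finset (Fin n) // π ∈ F ∧ i ∈ symmDiff π πs}, tau F μ δ πs π

/-! ### The two sampling models -/

/-- Stochastic noise: the `I t` are uniform on `[n]`, the `X i t`, `t = 0, 1, …`, are identically
distributed for each item `i`, the rounds `(I t, (X i t)_i)` are independent of each other, and
within a round the drawn item is independent of the outcomes.  (Independence of the outcomes of
different items within one round is not needed.) -/
structure StochasticSampling {Ω : Type*} [MeasurableSpace Ω] (P : Measure Ω)
    (I : ℕ → Ω → Fin n) (X : Fin n → ℕ → Ω → ℝ) : Prop where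
  measurable_draw : ∀ t, Measurable (I t)
  measurable_outcome : ∀ i t, Measurable (X i t)
  uniform : ∀ t i, P.real {ω | I t ω = i} = 1 / (n : ℝ)
  identDistrib : ∀ i t, IdentDistrib (X i t) (X i 0) P P
  indep_rounds : iIndepFun (fun (t : ℕ) (ω : Ω) => (I t ω, fun i => X i t ω)) P
  indep_draw : ∀ t, IndepFun (I t) (fun ω i => X i t ω) P

/-- Uniform sampling without replacement: given the first `t < n` draws, the next one is uniform on
the `n - t` items not drawn so far. -/
structure SamplingWithoutReplacement {Ω : Type*} [MeasurableSpace Ω] (P : Measure Ω)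
    (I : ℕ → Ω → Fin n) : Prop where
  measurable_draw : ∀ t, Measurable (I t)
  uniform : ∀ t < n, ∀ a : ℕ → Fin n, Set.InjOn a (Set.Iic t) →
    P.real {ω | ∀ s ≤ t, I s ω = a s} = P.real {ω | ∀ s < t, I s ω = a s} / ((n : ℝ) - t)

/-- The guarantee for stochastic noise: run with draws `I` and rewards `R`, the algorithm returns
`πs` within `c ∑_i max_π τ_π` samples, with probability greater than `1 - δ`. -/
def StochasticGuarantee (c : ℝ) (F : Finset (Finset (Fin n))) (πs : Finset (Fin n))
    (μ : Fin n → ℝ) (δ : ℝ) {Ω : Type*} [MeasurableSpace Ω] (P : Measure Ω)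
    (I : ℕ → Ω → Fin n) (R : Fin n → ℕ → Ω → ℝ) : Prop :=
  1 - δ < P.real {ω | ReturnsWithin ⊤ (run F (width F) δ (fun t => I t ω) (fun i t => R i t ω)) πs
    (c * ∑ i, maxTau F μ δ πs i)}

/-- The guarantee for persistent noise: every observation of item `i` equals `μ i`, at most `n`
items are drawn, and the bound is `c ∑_i min {1, max_π τ_π}`. -/
def PersistentGuarantee (c : ℝ) (F : Finset (Finset (Fin n))) (πs : Finset (Fin n))
    (μ : Fin n → ℝ) (δ : ℝ) {Ω : Type*} [MeasurableSpace Ω] (P : Measure Ω)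
    (I : ℕ → Ω → Fin n) : Prop :=
  1 - δ < P.real {ω | ReturnsWithin n (run F (width F) δ (fun t => I t ω) (fun i _ => μ i)) πs
    (c * ∑ i, min 1 (maxTau F μ δ πs i))}

end ActionElimination

end

open MeasureTheory ProbabilityTheory ActionElimination

universe u

namespace ActionElimination

section

/-! ### Bernstein's inequality -/

/-! The proof splits into a deterministic analysis on a good event and two probability estimates,
with failure probabilities at most `δ / 4` and `δ / 2`.

Good event (`Concentrated`): at the end of each round every estimated difference to `πs` is within
its width. On it `πs` is never eliminated, and a set surviving the test of round `k` has mean gap at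
most twice its width. Inverting the width gives `2 ^ (k + 1) ≤ 2816 n τ_π`, so `π` can be active
after `t` draws only if `t < 2816 n τ_π` (`run_invariant`). While `πs` is active, an item lies in
the disagreement set only if some active `π` differs from `πs` there. Items outside it contribute
nothing to differences between active sets, so skipping their rewards loses no information
(`observedSum_run_succ`).

Probability of the good event: with `d = |π ∆ πs|`, the summed rewards have variance proxy `t d /
n`, and the width is the Bernstein bound at exponent `4 V log (n / ε)`. Each deviation therefore has
probability at most `(ε / n) ^ (4 V)`. By Sauer–Shelah the sphere of radius `d` about `πs` has at
most `n ^ (2 min (V, d))` members, so a union bound over sets and rounds converges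
(`sum_pow_localVC_le`, `measureReal_not_concentrated_le`).

Number of samples: on the good event the adaptive count is dominated by a sum of indicators, each
depending only on one draw and its time (`length_obs_le`). Its mean is of the order of the claimed
bound, and a Chernoff bound adds only `log (2 / δ)`, which is itself at most `d τ_π` for any
suboptimal `π` (`count_tail`, `log_two_div_le_tau`).

Both estimates need only product bounds on exponential moments. These are equalities for independent
draws; without replacement they follow from an exchange inequality for random permutations
(`sum_perm_prod_le`). -/

lemma exp_mul_le_quadratic {z l : ℝ} (hz : |z| ≤ 1) (hl : 0 ≤ l) (hl3 : l < 3) :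
    Real.exp (l * z) ≤ 1 + l * z + z ^ 2 * (l ^ 2 / (2 * (1 - l / 3))) := by
  have h1 : HasSum (fun k : ℕ => (l * z) ^ k / (k.factorial : ℝ)) (Real.exp (l * z)) := by
    rw [Real.exp_eq_exp_ℝ]
    exact NormedSpace.expSeries_div_hasSum_exp (l * z)
  have h2 := (hasSum_nat_add_iff' 2).2 h1
  have h3 : HasSum (fun k : ℕ => z ^ 2 * l ^ 2 / 2 * (l / 3) ^ k)
      (z ^ 2 * l ^ 2 / 2 * (1 - l / 3)⁻¹) :=
    (hasSum_geometric_of_lt_one (by positivity) (by linarith)).mul_left _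
  -- Since `(k + 2)! ≥ 2 * 3 ^ k` and `|z| ≤ 1`, the exponential series from its quadratic term on
  -- is dominated by a geometric series of ratio `l / 3`.
  have h4 : ∀ k : ℕ, (l * z) ^ (k + 2) / ((k + 2).factorial : ℝ)
      ≤ z ^ 2 * l ^ 2 / 2 * (l / 3) ^ k := by
    intro k
    have hf : (2 : ℝ) * 3 ^ k ≤ ((k + 2).factorial : ℝ) := by
      have := Nat.factorial_mul_pow_le_factorial (m := 2) (n := k)
      rw [add_comm k 2]
      exact_mod_cast this
    have hzk : z ^ k ≤ 1 := by
      refine (le_abs_self _).trans ?_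
      rw [abs_pow]
      exact pow_le_one₀ (abs_nonneg z) hz
    calc (l * z) ^ (k + 2) / ((k + 2).factorial : ℝ)
        = (z ^ 2 * l ^ 2 * l ^ k * z ^ k) / ((k + 2).factorial : ℝ) := by ring
      _ ≤ (z ^ 2 * l ^ 2 * l ^ k * 1) / ((k + 2).factorial : ℝ) := by gcongr
      _ ≤ (z ^ 2 * l ^ 2 * l ^ k * 1) / (2 * 3 ^ k) := by gcongr
      _ = z ^ 2 * l ^ 2 / 2 * (l / 3) ^ k := by rw [div_pow]; field_simp
  have h5 := hasSum_le h4 h2 h3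
  simp only [Finset.sum_range_succ, Finset.sum_range_zero, pow_zero, Nat.factorial_zero,
    Nat.cast_one, pow_one, Nat.factorial_one, div_one, zero_add] at h5
  have h6 : z ^ 2 * l ^ 2 / 2 * (1 - l / 3)⁻¹ = z ^ 2 * (l ^ 2 / (2 * (1 - l / 3))) := by
    have : (1 - l / 3) ≠ 0 := by linarith
    field_simp
  linarith

/-- With `r = √(2B / v)` the square root becomes `r v`, and `l = 3r / (3 + r)` makes the Chernoff
exponent exactly `-B`. The degenerate case `B = 0` gives `l = 0`. -/
lemma exists_bernstein_parameter {v B : ℝ} (hv : 0 < v) (hB : 0 ≤ B) :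
    ∃ l : ℝ, 0 ≤ l ∧ l < 3 ∧
      v * (l ^ 2 / (2 * (1 - l / 3))) - l * (Real.sqrt (2 * v * B) + B / 3) = -B := by
  obtain ⟨r, hr, hrB⟩ : ∃ r : ℝ, 0 ≤ r ∧ r ^ 2 * v = 2 * B :=
    ⟨Real.sqrt (2 * B / v), Real.sqrt_nonneg _, by
      rw [Real.sq_sqrt (by positivity)]; field_simp⟩
  have hs : Real.sqrt (2 * v * B) = r * v := by
    rw [show 2 * v * B = (r * v) ^ 2 by linear_combination (-v) * hrB]
    exact Real.sqrt_sq (by positivity)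
  refine ⟨3 * r / (3 + r), by positivity, ?_, ?_⟩
  · rw [div_lt_iff₀ (by positivity)]; linarith
  · have h1 : 1 - 3 * r / (3 + r) / 3 = 3 / (3 + r) := by field_simp; ring
    have hB' : B = r ^ 2 * v / 2 := by linarith
    rw [h1, hs, hB']
    field_simp
    ring

lemma bernstein_tail {Ω : Type*} [MeasurableSpace Ω] {P : Measure Ω} [IsProbabilityMeasure P]
    {S : Ω → ℝ} {M v B : ℝ} (hv : 0 < v) (hB : 0 ≤ B)
    (hint : ∀ l : ℝ, 0 ≤ l → Integrable (fun ω => Real.exp (l * S ω)) P)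
    (hmgf : ∀ l : ℝ, 0 ≤ l → l < 3 →
      mgf S P l ≤ Real.exp (l * M + v * (l ^ 2 / (2 * (1 - l / 3))))) :
    P.real {ω | M + (Real.sqrt (2 * v * B) + B / 3) ≤ S ω} ≤ Real.exp (-B) := by
  obtain ⟨l, hl, hl3, he⟩ := exists_bernstein_parameter hv hB
  refine (measure_ge_le_exp_mul_mgf _ hl (hint l hl)).trans ?_
  refine (mul_le_mul_of_nonneg_left (hmgf l hl hl3) (Real.exp_pos _).le).trans ?_
  rw [← Real.exp_add]
  apply Real.exp_le_exp.2
  linarith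

/-! ### Counting spheres -/

variable {n : ℕ}

lemma symmDist_comm (π π' : Finset (Fin n)) : symmDist π π' = symmDist π' π := by
  rw [symmDist, symmDist, symmDiff_comm]

lemma symmDist_pos {π π' : Finset (Fin n)} (h : π ≠ π') : 1 ≤ symmDist π π' := by
  rw [symmDist, Nat.one_le_iff_ne_zero, Ne, Finset.card_eq_zero]
  exact fun h0 => h (symmDiff_eq_bot.1 h0)

lemma symmDist_le (π π' : Finset (Fin n)) : symmDist π π' ≤ n :=
  (Finset.card_le_univ _).trans_eq (Fintype.card_fin n)

lemma localVC_comm (F : Finset (Finset (Fin n))) (π π' : Finset (Fin n)) :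
    localVC F π π' = localVC F π' π := by
  rw [localVC, localVC, max_comm, symmDist_comm]

lemma width_comm (F : Finset (Finset (Fin n))) (π π' : Finset (Fin n)) (t : ℕ) (δ : ℝ) :
    width F π π' t δ = width F π' π t δ := by
  rw [width, width, localVC_comm, symmDist_comm]

lemma one_le_localVC (F : Finset (Finset (Fin n))) {π π' : Finset (Fin n)} (h : π ≠ π') :
    1 ≤ localVC F π π' :=
  le_min (le_max_of_le_left (le_max_left _ _)) (symmDist_pos h)

lemma localVC_le_symmDist (F : Finset (Finset (Fin n))) (π π' : Finset (Fin n)) :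
    localVC F π π' ≤ symmDist π π' := min_le_right _ _

/-- Sauer–Shelah, followed by `n.choose k ≤ n ^ k ≤ n ^ k * D.choose k` for `k ≤ D = A.vcDim` and
the binomial theorem. -/
lemma card_le_of_vcDim (A : Finset (Finset (Fin n))) : A.card ≤ (n + 1) ^ vc A := by
  have h := (Finset.card_le_card_shatterer A).trans Finset.card_shatterer_le_sum_vcDim
  rw [Fintype.card_fin] at h
  refine h.trans (le_trans ?_ (Nat.pow_le_pow_right (by omega) (le_max_right 1 A.vcDim)))
  rw [add_pow]
  simp only [one_pow, mul_one]
  rw [← Nat.range_succ_eq_Iic]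
  refine Finset.sum_le_sum fun k hk => ?_
  refine (Nat.choose_le_pow n k).trans (Nat.le_mul_of_pos_right _ (Nat.choose_pos ?_))
  simpa [Nat.lt_succ_iff] using hk

lemma card_sphere_le_choose (F : Finset (Finset (Fin n))) (d : ℕ) (π' : Finset (Fin n)) :
    (sphere F d π').card ≤ n.choose d := by
  have h : (sphere F d π').card ≤ (Finset.powersetCard d (Finset.univ : Finset (Fin n))).card := by
    refine Finset.card_le_card_of_injOn (fun π => symmDiff π π') ?_ ?_
    · intro π hπ
      exact Finset.mem_coe.2 (Finset.mem_powersetCard.2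
        ⟨Finset.subset_univ _, (Finset.mem_filter.1 (Finset.mem_coe.1 hπ)).2⟩)
    · intro a _ b _ hab
      exact symmDiff_left_injective π' hab
  simpa [Finset.card_powersetCard] using h

/-- The better of Sauer–Shelah and the trivial count of `d`-subsets. The factor 2 in the exponent
comes from `n + 1 ≤ n ^ 2`, which fails for `n = 1`; there the trivial count suffices. -/
lemma card_sphere_le (F : Finset (Finset (Fin n))) {d : ℕ} (hd : 1 ≤ d) (hdn : d ≤ n)
    (π' : Finset (Fin n)) :
    (sphere F d π').card ≤ n ^ (2 * min (vc (sphere F d π')) d) := by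
  rcases Nat.lt_or_ge 1 n with hn | hn
  · rcases le_total (vc (sphere F d π')) d with h | h
    · rw [min_eq_left h, pow_mul]
      exact (card_le_of_vcDim _).trans (Nat.pow_le_pow_left (by nlinarith) _)
    · rw [min_eq_right h]
      exact (card_sphere_le_choose F d π').trans ((Nat.choose_le_pow n d).trans
        (Nat.pow_le_pow_right (by omega) (by omega)))
  · have hn1 : n = 1 := by omega
    have hd1 : d = 1 := by omega
    have := card_sphere_le_choose F d π'
    subst hn1 hd1
    simpa using this

/-- The union bound of one round. Only the sphere about `πs` is counted, and the maximum inside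
`localVC` dominates its dimension. At distance `d` the `n ^ (2w)` sets against terms at most `(x /
n) ^ (4w)` leave `(x ^ 4 / n ^ 2) ^ w ≤ x ^ 4 / n`, which pays for the `n` possible distances. -/
lemma sum_pow_localVC_le (F : Finset (Finset (Fin n))) (πs : Finset (Fin n)) {x : ℝ}
    (hx : 0 ≤ x) (hx1 : x ≤ 1) :
    ∑ π ∈ F.erase πs, (x / n) ^ (4 * localVC F π πs) ≤ x ^ 4 := by
  rw [← Finset.sum_fiberwise_of_maps_to (t := Finset.Icc 1 n) (g := fun π => symmDist π πs)]
  · have key : ∀ d ∈ Finset.Icc 1 n, ∑ π ∈ F.erase πs with symmDist π πs = d,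
        (x / n) ^ (4 * localVC F π πs) ≤ x ^ 4 / n := by
      intro d hd
      obtain ⟨hd1, hdn⟩ := Finset.mem_Icc.1 hd
      have hn : (1 : ℝ) ≤ n := by exact_mod_cast hd1.trans hdn
      set w := min (vc (sphere F d πs)) d with hw
      have hw1 : 1 ≤ w := le_min (le_max_left _ _) hd1
      have hxn : x / n ≤ 1 := by
        rw [div_le_one (by linarith)]; linarith
      have h1 : ∑ π ∈ F.erase πs with symmDist π πs = d, (x / n) ^ (4 * localVC F π πs)
          ≤ ((F.erase πs).filter fun π => symmDist π πs = d).card • (x / n) ^ (4 * w) := by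
        refine Finset.sum_le_card_nsmul _ _ _ fun π hπ => ?_
        have hπd := (Finset.mem_filter.1 hπ).2
        refine pow_le_pow_of_le_one (by positivity) hxn (Nat.mul_le_mul_left 4 ?_)
        rw [localVC, hπd]
        exact min_le_min_right _ (le_max_right _ _)
      have h2 : ((F.erase πs).filter fun π => symmDist π πs = d).card ≤ n ^ (2 * w) :=
        (Finset.card_le_card (Finset.filter_subset_filter _ (Finset.erase_subset _ _))).trans
          (card_sphere_le F hd1 hdn πs)
      have h2' : (((F.erase πs).filter fun π => symmDist π πs = d).card : ℝ) ≤ (n : ℝ) ^ (2 * w) := by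
        exact_mod_cast h2
      refine h1.trans ?_
      rw [nsmul_eq_mul]
      refine (mul_le_mul_of_nonneg_right h2' (by positivity)).trans ?_
      have h3 : (n : ℝ) ^ (2 * w) * (x / n) ^ (4 * w) = (x ^ 4 / n ^ 2) ^ w := by
        rw [pow_mul, pow_mul, ← mul_pow]
        congr 1
        field_simp
      rw [h3]
      have h4 : x ^ 4 / (n : ℝ) ^ 2 ≤ x ^ 4 / n := by
        gcongr
        nlinarith
      have h5 : x ^ 4 / (n : ℝ) ^ 2 ≤ 1 := by
        rw [div_le_one (by positivity)]
        exact (pow_le_one₀ hx hx1).trans (one_le_pow₀ hn)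
      exact ((pow_le_pow_of_le_one (by positivity) h5 hw1).trans_eq (pow_one _)).trans h4
    refine (Finset.sum_le_card_nsmul _ _ _ key).trans ?_
    rw [nsmul_eq_mul, Nat.card_Icc, Nat.add_sub_cancel]
    rcases Nat.eq_zero_or_pos n with h0 | h0
    · subst h0; simp; positivity
    · have : (0 : ℝ) < n := by exact_mod_cast h0
      exact (mul_div_cancel₀ _ this.ne').le
  · intro π hπ
    exact Finset.mem_Icc.2 ⟨symmDist_pos (Finset.ne_of_mem_erase hπ), symmDist_le _ _⟩

/-! ### Inverting the confidence width -/

/-- Taking logarithms in the crude bound on `2 ^ k` gives `k ≤ 16 X`, so the round number costs only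
an iterated logarithm of the gap. The 11 is 1 for `log (2m)` plus 2 times 5 for `log k`. -/
lemma log_round_le {G X : ℝ} {k : ℕ} (hk : 1 ≤ k) {m : ℝ} (hm : 1 ≤ m) (hG : 1 ≤ G)
    (hX : X = m * max 2 (Real.log G)) (h : (2 : ℝ) ^ k ≤ 256 * m ^ 2 * G * (k : ℝ) ^ 2) :
    Real.log (2 * m * (k : ℝ) ^ 2) ≤ 11 * Real.log X := by
  have hk0 : (1 : ℝ) ≤ k := by exact_mod_cast hk
  have hM2 : 2 ≤ max 2 (Real.log G) := le_max_left _ _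
  have hMG : Real.log G ≤ max 2 (Real.log G) := le_max_right _ _
  set M := max 2 (Real.log G)
  have hX2 : 2 * m ≤ X := by rw [hX]; nlinarith
  have hXpos : 0 < X := by linarith
  have hkX : (k : ℝ) ≤ 16 * X := by
    have h1 := Real.log_le_log (by positivity) h
    rw [Real.log_pow, Real.log_mul (by positivity) (by positivity),
      Real.log_mul (by positivity) (by positivity), Real.log_mul (by positivity) (by positivity),
      Real.log_pow, Real.log_pow, show (256 : ℝ) = 2 ^ 8 by norm_num, Real.log_pow] at h1
    push_cast at h1
    -- The tangent of the logarithm at 8 bounds `2 log k` by `k / 4` plus a constant, which `k log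
    -- 2` absorbs.
    have h2 := Real.log_le_sub_one_of_pos (show (0 : ℝ) < k / 8 by positivity)
    rw [Real.log_div (by positivity) (by norm_num), show (8 : ℝ) = 2 ^ 3 by norm_num,
      Real.log_pow] at h2
    push_cast at h2
    have h3 := Real.log_le_sub_one_of_pos (show (0 : ℝ) < m by positivity)
    have h4 := Real.log_two_gt_d9
    have h5 := Real.log_two_lt_d9
    have h6 : M ≤ X := by rw [hX]; nlinarith
    have h7 : (k : ℝ) * 0.69 ≤ k * Real.log 2 :=
      mul_le_mul_of_nonneg_left (by linarith) (by linarith)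
    nlinarith
  have hlogX : Real.log 2 ≤ Real.log X := Real.log_le_log (by norm_num) (by linarith)
  have h1 : Real.log k ≤ 5 * Real.log X := by
    have := Real.log_le_log (by positivity) hkX
    rw [Real.log_mul (by norm_num) hXpos.ne', show (16 : ℝ) = 2 ^ 4 by norm_num,
      Real.log_pow] at this
    push_cast at this
    linarith
  have h2 : Real.log (2 * m) ≤ Real.log X := Real.log_le_log (by positivity) hX2
  rw [Real.log_mul (by positivity) (by positivity), Real.log_pow]
  push_cast
  linarith

/-- A bootstrap: `log y ≤ y` first gives a polynomial bound on `2 ^ k`, from which `log_round_le`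
removes `k` from the logarithm. Here `2816 = 2 * 128 * 11`, the 2 being for the next power. -/
lemma pow_two_le_of_le_log {m w G : ℝ} {n k : ℕ} (hk : 1 ≤ k) (hn : (1 : ℝ) ≤ n) (hnm : n ≤ m)
    (hG : 1 ≤ G) (hw : 0 ≤ w) (hwG : w ≤ G)
    (h : (2 : ℝ) ^ k ≤ 128 * (n * w) * Real.log (2 * m * (k : ℝ) ^ 2)) :
    (2 : ℝ) ^ (k + 1) ≤ 2816 * (n * (w * Real.log (m * max 2 (Real.log G)))) := by
  have hm : 1 ≤ m := hn.trans hnm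
  have hk0 : (1 : ℝ) ≤ k := by exact_mod_cast hk
  have h1 : Real.log (2 * m * (k : ℝ) ^ 2) ≤ 2 * m * (k : ℝ) ^ 2 :=
    (Real.log_le_sub_one_of_pos (by positivity)).trans (by linarith)
  have h0 : 0 ≤ Real.log (2 * m * (k : ℝ) ^ 2) := Real.log_nonneg (by nlinarith)
  have h2 : (2 : ℝ) ^ k ≤ 256 * m ^ 2 * G * (k : ℝ) ^ 2 := by
    refine h.trans ?_
    calc 128 * (n * w) * Real.log (2 * m * (k : ℝ) ^ 2)
        ≤ 128 * (m * G) * (2 * m * (k : ℝ) ^ 2) := by gcongr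
      _ = 256 * m ^ 2 * G * (k : ℝ) ^ 2 := by ring
  have h3 := log_round_le hk hm hG rfl h2
  have h4 := h.trans (mul_le_mul_of_nonneg_left h3 (by positivity))
  rw [pow_succ]
  linarith

end

section

/-! ### Uniformly random permutations -/

/-- An exchange argument: compose `σ` with the transposition of `t` and `j`. If `j ∉ T` this gives
equality. If `j ∈ T`, symmetrizing turns twice the difference of the two sides into a sum of
nonnegative multiples of `(f j (σ j) - f j (σ t)) * (f t (σ j) - f t (σ t))`, nonnegative by similar
ordering. -/
lemma sum_perm_prod_mul_le {ι : Type*} [Fintype ι] [DecidableEq ι] {f : ι → ι → ℝ}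
    (hf : ∀ s i, 0 ≤ f s i) (hmono : ∀ s t a b, 0 ≤ (f s a - f s b) * (f t a - f t b))
    {T : Finset ι} {t : ι} (ht : t ∉ T) (j : ι) :
    ∑ σ : Equiv.Perm ι, (∏ s ∈ T, f s (σ s)) * f t (σ t)
      ≤ ∑ σ : Equiv.Perm ι, (∏ s ∈ T, f s (σ s)) * f t (σ j) := by
  have reindex : ∀ g : Equiv.Perm ι → ℝ, ∑ σ, g (σ * Equiv.swap t j) = ∑ σ, g σ := fun g =>
    Fintype.sum_equiv (Equiv.mulRight (Equiv.swap t j)) _ _ fun σ => rfl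
  have fix : ∀ s ∈ T, s ≠ j → ∀ σ : Equiv.Perm ι, (σ * Equiv.swap t j) s = σ s := by
    intro s hs hsj σ
    rw [Equiv.Perm.mul_apply,
      Equiv.swap_apply_of_ne_of_ne (fun h : s = t => ht (h ▸ hs)) hsj]
  have hσt : ∀ σ : Equiv.Perm ι, (σ * Equiv.swap t j) t = σ j := by simp
  have hσj : ∀ σ : Equiv.Perm ι, (σ * Equiv.swap t j) j = σ t := by simp
  by_cases hj : j ∈ T
  · have hq : ∀ σ : Equiv.Perm ι, ∏ s ∈ T.erase j, f s ((σ * Equiv.swap t j) s)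
        = ∏ s ∈ T.erase j, f s (σ s) := fun σ =>
      Finset.prod_congr rfl fun s hs => by
        rw [fix s (Finset.mem_of_mem_erase hs) (Finset.ne_of_mem_erase hs)]
    simp only [← Finset.mul_prod_erase T _ hj]
    have h1 := reindex fun σ => f j (σ j) * (∏ s ∈ T.erase j, f s (σ s)) * f t (σ t)
    have h2 := reindex fun σ => f j (σ j) * (∏ s ∈ T.erase j, f s (σ s)) * f t (σ j)
    simp only [hq, hσt, hσj] at h1 h2
    have h3 : 0 ≤ ∑ σ : Equiv.Perm ι, (∏ s ∈ T.erase j, f s (σ s)) *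
        ((f j (σ j) - f j (σ t)) * (f t (σ j) - f t (σ t))) :=
      Finset.sum_nonneg fun σ _ =>
        mul_nonneg (Finset.prod_nonneg fun s _ => hf _ _) (hmono _ _ _ _)
    have h4 : ∑ σ : Equiv.Perm ι, (∏ s ∈ T.erase j, f s (σ s)) *
        ((f j (σ j) - f j (σ t)) * (f t (σ j) - f t (σ t)))
        = (∑ σ : Equiv.Perm ι, f j (σ j) * (∏ s ∈ T.erase j, f s (σ s)) * f t (σ j)
          + ∑ σ : Equiv.Perm ι, f j (σ t) * (∏ s ∈ T.erase j, f s (σ s)) * f t (σ t))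
          - (∑ σ : Equiv.Perm ι, f j (σ j) * (∏ s ∈ T.erase j, f s (σ s)) * f t (σ t)
          + ∑ σ : Equiv.Perm ι, f j (σ t) * (∏ s ∈ T.erase j, f s (σ s)) * f t (σ j)) := by
      simp only [← Finset.sum_add_distrib, ← Finset.sum_sub_distrib]
      exact Finset.sum_congr rfl fun σ _ => by ring
    linarith
  · have h1 := reindex fun σ => (∏ s ∈ T, f s (σ s)) * f t (σ t)
    have hq : ∀ σ : Equiv.Perm ι, ∏ s ∈ T, f s ((σ * Equiv.swap t j) s) = ∏ s ∈ T, f s (σ s) :=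
      fun σ => Finset.prod_congr rfl fun s hs => by rw [fix s hs fun h => hj (h ▸ hs)]
    simp only [hq, hσt] at h1
    exact h1.ge

/-- Under a uniformly random permutation `σ`, the expectation of `∏ f s (σ s)` is at most the
product of the expectations, if the functions `f s` are nonnegative and similarly ordered. -/
lemma sum_perm_prod_le {ι : Type*} [Fintype ι] [DecidableEq ι] {f : ι → ι → ℝ}
    (hf : ∀ s i, 0 ≤ f s i) (hmono : ∀ s t a b, 0 ≤ (f s a - f s b) * (f t a - f t b))
    (T : Finset ι) :
    ∑ σ : Equiv.Perm ι, ∏ s ∈ T, f s (σ s)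
      ≤ (Fintype.card ι).factorial * ∏ s ∈ T, ((1 / (Fintype.card ι : ℝ)) * ∑ i, f s i) := by
  induction T using Finset.induction_on with
  | empty => simp [Fintype.card_perm]
  | insert t T ht ih =>
    have hcard : (0 : ℝ) < Fintype.card ι := by exact_mod_cast Fintype.card_pos_iff.2 ⟨t⟩
    have hmean : 0 ≤ (1 / (Fintype.card ι : ℝ)) * ∑ i, f t i :=
      mul_nonneg (by positivity) (Finset.sum_nonneg fun i _ => hf _ _)
    -- Averaging the exchange inequality over `j` decouples the new factor, because `∑ j, f t (σ j)`
    -- does not depend on `σ`.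
    have h1 : (Fintype.card ι : ℝ) * ∑ σ : Equiv.Perm ι, (∏ s ∈ T, f s (σ s)) * f t (σ t)
        ≤ (∑ σ : Equiv.Perm ι, ∏ s ∈ T, f s (σ s)) * ∑ i, f t i := by
      calc (Fintype.card ι : ℝ) * ∑ σ : Equiv.Perm ι, (∏ s ∈ T, f s (σ s)) * f t (σ t)
          = ∑ _j : ι, ∑ σ : Equiv.Perm ι, (∏ s ∈ T, f s (σ s)) * f t (σ t) := by
            rw [Finset.sum_const, nsmul_eq_mul, Finset.card_univ]
        _ ≤ ∑ j : ι, ∑ σ : Equiv.Perm ι, (∏ s ∈ T, f s (σ s)) * f t (σ j) :=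
            Finset.sum_le_sum fun j _ => sum_perm_prod_mul_le hf hmono ht j
        _ = (∑ σ : Equiv.Perm ι, ∏ s ∈ T, f s (σ s)) * ∑ i, f t i := by
            rw [Finset.sum_comm, Finset.sum_mul]
            refine Finset.sum_congr rfl fun σ _ => ?_
            rw [← Finset.mul_sum, Equiv.sum_comp σ (f t)]
    have h2 : ∑ σ : Equiv.Perm ι, (∏ s ∈ T, f s (σ s)) * f t (σ t)
        ≤ (∑ σ : Equiv.Perm ι, ∏ s ∈ T, f s (σ s))
          * ((1 / (Fintype.card ι : ℝ)) * ∑ i, f t i) := by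
      rw [← mul_le_mul_iff_right₀ hcard]
      refine h1.trans_eq ?_
      field_simp
    simp only [Finset.prod_insert ht]
    simp only [mul_comm (f t _)]
    refine (h2.trans (mul_le_mul_of_nonneg_right ih hmean)).trans_eq ?_
    ring

/-! ### Sampling without replacement -/

variable {n : ℕ} {Ω : Type*} [MeasurableSpace Ω] {P : Measure Ω} {I : ℕ → Ω → Fin n}

namespace SamplingWithoutReplacement

lemma measurable_draws (hI : SamplingWithoutReplacement P I) :
    Measurable fun ω (s : Fin n) => I s ω :=
  measurable_pi_iff.2 fun s => hI.measurable_draw s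

variable [IsProbabilityMeasure P]

lemma measureReal_prefix (hI : SamplingWithoutReplacement P I) {t : ℕ} (ht : t ≤ n)
    {a : ℕ → Fin n} (ha : Set.InjOn a (Set.Iio t)) :
    P.real {ω | ∀ s < t, I s ω = a s} * n.factorial = (n - t).factorial := by
  induction t with
  | zero => simp
  | succ t ih =>
    have ha' : Set.InjOn a (Set.Iic t) := fun x hx y hy h =>
      ha (Nat.lt_succ_of_le hx) (Nat.lt_succ_of_le hy) h
    have h1 := hI.uniform t ht a ha'
    have h2 := ih (by omega) (ha.mono fun x hx => Nat.lt_succ_of_lt hx)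
    have h3 : {ω | ∀ s < t + 1, I s ω = a s} = {ω | ∀ s ≤ t, I s ω = a s} := by
      ext ω; simp
    have h4 : (n - t).factorial = (n - t) * (n - (t + 1)).factorial := by
      rw [show n - t = (n - (t + 1)) + 1 by omega, Nat.factorial_succ]
    have h5 : (0 : ℝ) < (n : ℝ) - t := by
      have : (t : ℝ) < n := by exact_mod_cast ht
      linarith
    rw [h3, h1, div_mul_eq_mul_div, h2, h4, Nat.cast_mul, Nat.cast_sub (by omega)]
    field_simp

lemma map_draws_real_perm (hI : SamplingWithoutReplacement P I) (σ : Equiv.Perm (Fin n)) :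
    (P.map fun ω (s : Fin n) => I s ω).real {⇑σ} = 1 / n.factorial := by
  obtain ⟨ω₀⟩ := nonempty_of_isProbabilityMeasure P
  rw [map_measureReal_apply hI.measurable_draws (measurableSet_singleton _)]
  -- The prefix lemma takes a sequence on all of `ℕ`. Its values from `n` on are irrelevant; the
  -- draws at `ω₀` supply some element of `Fin n`.
  have h := hI.measureReal_prefix le_rfl (a := fun s => if h : s < n then σ ⟨s, h⟩ else I s ω₀) (by
    intro x hx y hy h
    simp only [Set.mem_Iio] at hx hy
    simp only [hx, hy, dite_true] at h
    simpa using σ.injective h)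
  have hset : (fun ω (s : Fin n) => I s ω) ⁻¹' {⇑σ} = {ω | ∀ s < n, I s ω =
      if h : s < n then σ ⟨s, h⟩ else I s ω₀} := by
    ext ω
    simp only [Set.mem_preimage, Set.mem_singleton_iff, funext_iff]
    constructor
    · intro h s hs
      simpa [hs] using h ⟨s, hs⟩
    · intro h s
      simpa using h s s.2
  rw [hset, eq_div_iff (by positivity), h]
  simp

lemma sum_map_draws_real (hI : SamplingWithoutReplacement P I) :
    ∑ σ : Equiv.Perm (Fin n), (P.map fun ω (s : Fin n) => I s ω).real {⇑σ} = 1 := by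
  simp only [hI.map_draws_real_perm, Finset.sum_const, Finset.card_univ, Fintype.card_perm,
    Fintype.card_fin, nsmul_eq_mul]
  field_simp

/-- The `n!` permutations have mass `1 / n!` each and so exhaust the total mass; all other draw
sequences are null. -/
lemma sum_eq_sum_perm (hI : SamplingWithoutReplacement P I) (g : (Fin n → Fin n) → ℝ) :
    ∑ a, (P.map fun ω (s : Fin n) => I s ω).real {a} * g a
      = ∑ σ : Equiv.Perm (Fin n), (1 / (n.factorial : ℝ)) * g σ := by
  classical
  set Q := P.map fun ω (s : Fin n) => I s ω with hQ
  have : IsProbabilityMeasure Q := Measure.isProbabilityMeasure_map hI.measurable_draws.aemeasurable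
  set e : Equiv.Perm (Fin n) ↪ (Fin n → Fin n) := ⟨fun σ => σ, Equiv.coe_fn_injective⟩
  have htot : ∑ a, Q.real {a} = 1 := by
    rw [sum_measureReal_singleton]; simp
  have hperm : ∑ a ∈ Finset.univ.map e, Q.real {a} = 1 := by
    rw [Finset.sum_map]; exact hI.sum_map_draws_real
  have hrest : ∑ a ∈ (Finset.univ.map e)ᶜ, Q.real {a} = 0 := by
    have := Finset.sum_add_sum_compl (Finset.univ.map e) fun a => Q.real {a}
    linarith
  have hzero := (Finset.sum_eq_zero_iff_of_nonneg fun a _ => measureReal_nonneg).1 hrest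
  rw [← Finset.sum_add_sum_compl (Finset.univ.map e), Finset.sum_map,
    Finset.sum_eq_zero (s := (Finset.univ.map e)ᶜ) fun a ha => by rw [hzero a ha, zero_mul],
    add_zero]
  exact Finset.sum_congr rfl fun σ _ => by rw [← hI.map_draws_real_perm σ]; rfl

lemma integral_draws (hI : SamplingWithoutReplacement P I) (g : (Fin n → Fin n) → ℝ) :
    ∫ ω, g (fun s => I s ω) ∂P
      = (1 / (n.factorial : ℝ)) * ∑ σ : Equiv.Perm (Fin n), g σ := by
  have : IsProbabilityMeasure (P.map fun ω (s : Fin n) => I s ω) :=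
    Measure.isProbabilityMeasure_map hI.measurable_draws.aemeasurable
  rw [Finset.mul_sum, ← hI.sum_eq_sum_perm g, ← integral_map (f := g)
    hI.measurable_draws.aemeasurable (measurable_of_finite g).aestronglyMeasurable,
    integral_fintype (Integrable.of_finite)]
  simp [smul_eq_mul]

lemma ae_injective (hI : SamplingWithoutReplacement P I) :
    P.real {ω | ¬ Function.Injective fun s : Fin n => I s ω} = 0 := by
  classical
  have h := hI.integral_draws fun a => if Function.Injective a then 0 else 1
  have h0 : ∀ σ : Equiv.Perm (Fin n), Function.Injective ⇑σ := fun σ => σ.injective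
  simp only [h0, if_true, Finset.sum_const_zero, mul_zero] at h
  have hset : MeasurableSet {ω | ¬ Function.Injective fun s : Fin n => I s ω} :=
    hI.measurable_draws (Set.toFinite {a | ¬ Function.Injective a}).measurableSet
  rw [← integral_indicator_one hset, ← h]
  congr 1
  ext ω
  by_cases hω : Function.Injective fun s : Fin n => I s ω <;> simp [Set.indicator, hω]

/-- Hoeffding's comparison with sampling with replacement, extended from one function to a similarly
ordered family. It serves both for the rewards and for the sample count. -/
lemma integral_prod_le (hI : SamplingWithoutReplacement P I) {t : ℕ} (ht : t ≤ n)
    {f : ℕ → Fin n → ℝ} (hf : ∀ s i, 0 ≤ f s i)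
    (hmono : ∀ s t a b, 0 ≤ (f s a - f s b) * (f t a - f t b)) :
    ∫ ω, ∏ s ∈ Finset.range t, f s (I s ω) ∂P
      ≤ ∏ s ∈ Finset.range t, ((1 / (n : ℝ)) * ∑ i, f s i) := by
  have key : ∀ F : ℕ → ℝ, ∏ s ∈ Finset.range t, F s
      = ∏ s : Fin n with s.val < t, F s := by
    intro F
    rw [Finset.prod_filter, ← Finset.prod_range fun s => if s < t then F s else 1,
      ← Finset.prod_filter]
    congr 1
    ext s
    simp only [Finset.mem_range, Finset.mem_filter]
    omega
  have h := hI.integral_draws fun a => ∏ s : Fin n with s.val < t, f s (a s)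
  have h2 := sum_perm_prod_le (ι := Fin n) (f := fun s => f s) (fun s i => hf s i)
    (fun s u a b => hmono s u a b) (Finset.univ.filter fun s : Fin n => s.val < t)
  simp only [key]
  rw [h, one_div, inv_mul_le_iff₀ (by positivity)]
  simpa using h2

end SamplingWithoutReplacement

end

section

variable {n : ℕ}

/-! ### Signed indicators -/

/-- The difference of the indicators of `π'` and `π` at `i`. -/
def signedIndicator (π' π : Finset (Fin n)) (i : Fin n) : ℝ :=
  (if i ∈ π' then 1 else 0) - (if i ∈ π then 1 else 0)

lemma abs_signedIndicator_le (π' π : Finset (Fin n)) (i : Fin n) :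
    |signedIndicator π' π i| ≤ 1 := by
  unfold signedIndicator; split_ifs <;> norm_num

lemma signedIndicator_swap (π' π : Finset (Fin n)) (i : Fin n) :
    signedIndicator π' π i = -signedIndicator π π' i := by
  unfold signedIndicator; ring

lemma signedIndicator_sq (π' π : Finset (Fin n)) (i : Fin n) :
    signedIndicator π' π i ^ 2 = if i ∈ symmDiff π' π then 1 else 0 := by
  simp only [signedIndicator, Finset.mem_symmDiff]
  by_cases h1 : i ∈ π' <;> by_cases h2 : i ∈ π <;> simp [h1, h2]

lemma sum_signedIndicator_sq (π' π : Finset (Fin n)) :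
    ∑ i, signedIndicator π' π i ^ 2 = symmDist π' π := by
  simp [signedIndicator_sq, symmDist]

lemma setMean_sub (μ : Fin n → ℝ) (π' π : Finset (Fin n)) :
    setMean μ π' - setMean μ π = ∑ i, signedIndicator π' π i * μ i := by
  simp [setMean, signedIndicator, sub_mul, Finset.sum_sub_distrib]

lemma abs_setMean_sub_le {μ : Fin n → ℝ} (hμ : ∀ i, μ i ∈ Set.Icc (-1 : ℝ) 1)
    (π' π : Finset (Fin n)) : |setMean μ π' - setMean μ π| ≤ symmDist π' π := by
  rw [setMean_sub, ← sum_signedIndicator_sq]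
  refine (Finset.abs_sum_le_sum_abs _ _).trans (Finset.sum_le_sum fun i _ => ?_)
  have h1 : |μ i| ≤ 1 := abs_le.2 (hμ i)
  have h2 : |signedIndicator π' π i| = signedIndicator π' π i ^ 2 := by
    unfold signedIndicator; split_ifs <;> norm_num
  rw [abs_mul, h2]
  exact mul_le_of_le_one_right (sq_nonneg _) h1

/-! ### Gaps and sample complexities -/

lemma gap_pos {μ : Fin n → ℝ} {πs π : Finset (Fin n)} (h : setMean μ π < setMean μ πs) :
    0 < gap μ πs π := by
  have hne : π ≠ πs := fun h0 => by simp [h0] at h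
  have : (0 : ℝ) < symmDist π πs := by exact_mod_cast symmDist_pos hne
  exact div_pos (abs_pos.2 (by linarith)) this

lemma gap_le_one {μ : Fin n → ℝ} (hμ : ∀ i, μ i ∈ Set.Icc (-1 : ℝ) 1)
    (πs π : Finset (Fin n)) : gap μ πs π ≤ 1 :=
  div_le_one_of_le₀ (abs_setMean_sub_le hμ π πs) (Nat.cast_nonneg _)

lemma symmDist_mul_gap {μ : Fin n → ℝ} {πs π : Finset (Fin n)}
    (h : setMean μ π < setMean μ πs) :
    symmDist π πs * gap μ πs π = setMean μ πs - setMean μ π := by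
  have hne : π ≠ πs := fun h0 => by simp [h0] at h
  have : (0 : ℝ) < symmDist π πs := by exact_mod_cast symmDist_pos hne
  rw [gap, mul_div_cancel₀ _ this.ne', abs_sub_comm, abs_of_pos (by linarith)]

lemma one_le_of_ne {π π' : Finset (Fin n)} (h : π ≠ π') : 1 ≤ n :=
  (symmDist_pos h).trans (symmDist_le π π')

/-- Allows the additive Chernoff term to be absorbed into the sample bound. The truncation at 2 in
`tau` is what yields `2 / δ` even for `n = 1`. -/
lemma log_two_div_le_tau {F : Finset (Finset (Fin n))} {μ : Fin n → ℝ} {δ : ℝ}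
    {πs π : Finset (Fin n)} (hμ : ∀ i, μ i ∈ Set.Icc (-1 : ℝ) 1) (hδ : 0 < δ) (hδ1 : δ < 1)
    (h : setMean μ π < setMean μ πs) :
    Real.log (2 / δ) ≤ symmDist π πs * tau F μ δ πs π := by
  have hne : π ≠ πs := fun h0 => by simp [h0] at h
  have hd : (0 : ℝ) < symmDist π πs := by exact_mod_cast symmDist_pos hne
  have hn : (1 : ℝ) ≤ n := by exact_mod_cast one_le_of_ne hne
  have hV : (1 : ℝ) ≤ localVC F π πs := by exact_mod_cast one_le_localVC F hne
  have hG : 1 ≤ 1 / gap μ πs π ^ 2 := by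
    rw [le_div_iff₀ (pow_pos (gap_pos h) 2), one_mul]
    exact pow_le_one₀ (gap_pos h).le (gap_le_one hμ πs π)
  have hlog : Real.log (2 / δ) ≤
      Real.log (n * max 2 (Real.log (1 / gap μ πs π ^ 2)) / δ) := by
    apply Real.log_le_log (by positivity)
    gcongr
    nlinarith [le_max_left 2 (Real.log (1 / gap μ πs π ^ 2))]
  have hlog0 : 0 ≤ Real.log (2 / δ) := Real.log_nonneg (by rw [le_div_iff₀ hδ]; linarith)
  rw [tau, symmDist_comm πs π]
  have : (symmDist π πs : ℝ) * ((localVC F π πs : ℝ) / symmDist π πs * (1 / gap μ πs π ^ 2)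
      * Real.log (n * max 2 (Real.log (1 / gap μ πs π ^ 2)) / δ))
      = (localVC F π πs * (1 / gap μ πs π ^ 2))
      * Real.log (n * max 2 (Real.log (1 / gap μ πs π ^ 2)) / δ) := by
    field_simp
  rw [this]
  refine hlog.trans (le_mul_of_one_le_left (hlog0.trans hlog) ?_)
  nlinarith

lemma log_two_div_ge {δ : ℝ} (hδ : 0 < δ) (hδ1 : δ < 1) : 1 / 2 ≤ Real.log (2 / δ) := by
  have h1 : Real.log 2 ≤ Real.log (2 / δ) := by
    apply Real.log_le_log (by norm_num)
    rw [le_div_iff₀ hδ]; linarith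
  linarith [Real.log_two_gt_d9]

lemma tau_pos {F : Finset (Finset (Fin n))} {μ : Fin n → ℝ} {δ : ℝ}
    {πs π : Finset (Fin n)} (hμ : ∀ i, μ i ∈ Set.Icc (-1 : ℝ) 1) (hδ : 0 < δ) (hδ1 : δ < 1)
    (h : setMean μ π < setMean μ πs) : 0 < tau F μ δ πs π := by
  have := log_two_div_le_tau (F := F) hμ hδ hδ1 h
  have h2 := log_two_div_ge hδ hδ1
  exact pos_of_mul_pos_right (by linarith) (Nat.cast_nonneg (symmDist π πs))

/-- Starts the induction of `run_invariant` and absorbs the rounding in `sum_mayBeSampled_le`. -/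
lemma half_le_mul_tau {F : Finset (Finset (Fin n))} {μ : Fin n → ℝ} {δ : ℝ}
    {πs π : Finset (Fin n)} (hμ : ∀ i, μ i ∈ Set.Icc (-1 : ℝ) 1) (hδ : 0 < δ) (hδ1 : δ < 1)
    (h : setMean μ π < setMean μ πs) : 1 / 2 ≤ n * tau F μ δ πs π := by
  have h1 := log_two_div_le_tau (F := F) hμ hδ hδ1 h
  have h2 := log_two_div_ge hδ hδ1
  have h3 : (symmDist π πs : ℝ) ≤ n := by exact_mod_cast symmDist_le π πs
  have h4 := mul_le_mul_of_nonneg_right h3 (tau_pos (F := F) hμ hδ hδ1 h).le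
  linarith

lemma tau_le_maxTau {F : Finset (Finset (Fin n))} (μ : Fin n → ℝ) (δ : ℝ)
    {πs π : Finset (Fin n)} (hπ : π ∈ F) {i : Fin n} (hi : i ∈ symmDiff π πs) :
    tau F μ δ πs π ≤ maxTau F μ δ πs i :=
  le_ciSup (f := fun π : {π : Finset (Fin n) // π ∈ F ∧ i ∈ symmDiff π πs} => tau F μ δ πs π)
    (Set.finite_range _).bddAbove ⟨π, hπ, hi⟩

section

variable {F : Finset (Finset (Fin n))} {μ : Fin n → ℝ} {δ : ℝ} {πs : Finset (Fin n)}

lemma exists_maxTau_eq {i : Fin n} (h : ∃ π ∈ F, i ∈ symmDiff π πs) :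
    ∃ π ∈ F, i ∈ symmDiff π πs ∧ maxTau F μ δ πs i = tau F μ δ πs π := by
  obtain ⟨π, hπ, hi⟩ := h
  have : Nonempty {π : Finset (Fin n) // π ∈ F ∧ i ∈ symmDiff π πs} := ⟨⟨π, hπ, hi⟩⟩
  obtain ⟨⟨π', h1, h2⟩, h3⟩ := exists_eq_ciSup_of_finite
    (f := fun π : {π : Finset (Fin n) // π ∈ F ∧ i ∈ symmDiff π πs} => tau F μ δ πs π)
  exact ⟨π', h1, h2, h3.symm⟩

lemma maxTau_eq_zero {i : Fin n} (h : ¬ ∃ π ∈ F, i ∈ symmDiff π πs) :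
    maxTau F μ δ πs i = 0 := by
  have : IsEmpty {π : Finset (Fin n) // π ∈ F ∧ i ∈ symmDiff π πs} :=
    ⟨fun π => h ⟨π.1, π.2⟩⟩
  exact Real.iSup_of_isEmpty _

lemma ne_of_mem_symmDiff {π : Finset (Fin n)} {i : Fin n} (hi : i ∈ symmDiff π πs) : π ≠ πs := by
  rintro rfl
  simp at hi

lemma maxTau_nonneg (hμ : ∀ i, μ i ∈ Set.Icc (-1 : ℝ) 1) (hδ : 0 < δ) (hδ1 : δ < 1)
    (hbest : ∀ π ∈ F, π ≠ πs → setMean μ π < setMean μ πs) (i : Fin n) :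
    0 ≤ maxTau F μ δ πs i :=
  Real.iSup_nonneg fun π =>
    (tau_pos hμ hδ hδ1 (hbest π.1 π.2.1 (ne_of_mem_symmDiff π.2.2))).le

/-! ### Confidence widths -/

/-- For larger `x` the square root is at most `d g / 4` and, since `g ^ 2 ≤ g`, the linear term at
most `d g / 96`; twice their sum is below `d g`. -/
lemma le_of_gap_le_width {d V L x g m : ℝ} (hd : 0 < d) (_hV : 0 ≤ V) (_hL : 0 ≤ L) (_hm : 0 ≤ m)
    (hx : 0 < x) (hg : 0 < g) (hg1 : g ≤ 1)
    (h : d * g ≤ 2 * (Real.sqrt (8 * d * m * V * L / x) + 4 * m * V * L / (3 * x))) :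
    x ≤ 128 * (m * (V / d * (1 / g ^ 2))) * L := by
  by_contra! hlt
  have h1 : m * V * L / x < d * g ^ 2 / 128 := by
    rw [div_lt_iff₀ hx]
    have : 128 * (m * (V / d * (1 / g ^ 2))) * L = 128 * (m * V * L) / (d * g ^ 2) := by
      field_simp
    rw [this, div_lt_iff₀ (by positivity)] at hlt
    linarith
  have h2 : Real.sqrt (8 * d * m * V * L / x) ≤ d * g / 4 := by
    apply Real.sqrt_le_iff.2 ⟨by positivity, ?_⟩
    have : 8 * d * m * V * L / x = 8 * d * (m * V * L / x) := by ring
    rw [this]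
    nlinarith [mul_lt_mul_of_pos_left h1 hd]
  have h3 : 4 * m * V * L / (3 * x) = 4 / 3 * (m * V * L / x) := by field_simp
  rw [h3] at h
  have h4 : d * g ^ 2 ≤ d * g := by nlinarith [mul_pos hd hg]
  nlinarith [mul_pos hd hg]

lemma width_self (F : Finset (Finset (Fin n))) (π : Finset (Fin n)) (t : ℕ) (ε : ℝ) :
    width F π π t ε = 0 := by
  simp [width, localVC, symmDist]

lemma pow_le_tau_of_le_width {π : Finset (Fin n)} (hμ : ∀ i, μ i ∈ Set.Icc (-1 : ℝ) 1)
    (hδ : 0 < δ) (hδ1 : δ < 1) (hlt : setMean μ π < setMean μ πs) {k : ℕ} (hk : 1 ≤ k)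
    (h : setMean μ πs - setMean μ π ≤ 2 * width F π πs (2 ^ k) (δ / (2 * (k : ℝ) ^ 2))) :
    (2 : ℝ) ^ (k + 1) ≤ 2816 * (n * tau F μ δ πs π) := by
  have hne : π ≠ πs := fun h0 => by simp [h0] at hlt
  have hd : (0 : ℝ) < symmDist π πs := by exact_mod_cast symmDist_pos hne
  have hn : (1 : ℝ) ≤ n := by exact_mod_cast one_le_of_ne hne
  have hk0 : (1 : ℝ) ≤ k := by exact_mod_cast hk
  have hg := gap_pos hlt
  have hg1 := gap_le_one hμ πs π
  have hm : (n : ℝ) ≤ n / δ := by rw [le_div_iff₀ hδ]; nlinarith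
  have hm1 : 1 ≤ n / δ := hn.trans hm
  have hk2 : 1 ≤ (k : ℝ) ^ 2 := one_le_pow₀ hk0
  have hlog : (n : ℝ) / (δ / (2 * (k : ℝ) ^ 2)) = 2 * (n / δ) * (k : ℝ) ^ 2 := by field_simp
  -- The cap of `localVC` at the distance keeps the weight `w = V / (d gap ^ 2)` below `G = 1 / gap
  -- ^ 2`, so that only `G` enters the logarithm.
  have hVd : (localVC F π πs : ℝ) / symmDist π πs ≤ 1 :=
    div_le_one_of_le₀ (by exact_mod_cast localVC_le_symmDist F π πs) hd.le
  have hG : 1 ≤ 1 / gap μ πs π ^ 2 := by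
    rw [le_div_iff₀ (pow_pos hg 2), one_mul]
    exact pow_le_one₀ hg.le hg1
  rw [← symmDist_mul_gap hlt, width, hlog] at h
  push_cast at h
  have h1 := le_of_gap_le_width hd (Nat.cast_nonneg _)
    (Real.log_nonneg (by nlinarith)) (Nat.cast_nonneg n) (by positivity) hg hg1 h
  have h2 := pow_two_le_of_le_log hk hn hm hG (by positivity)
    (mul_le_of_le_one_left (by linarith) hVd) h1
  rw [tau, symmDist_comm πs π]
  convert h2 using 6
  ring

/-! ### The trajectory -/

lemma mem_disagreement {A : Finset (Finset (Fin n))} {i : Fin n} :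
    i ∈ disagreement A ↔ (∃ π ∈ A, i ∈ π) ∧ ∃ π ∈ A, i ∉ π := by
  simp [disagreement, Finset.mem_sup, Finset.mem_inf]

/-- Links the items being sampled to the index set of `maxTau`: if two members disagree at `i`, one
of them disagrees with `πs` there. -/
lemma exists_mem_symmDiff {A : Finset (Finset (Fin n))} (hs : πs ∈ A) {i : Fin n} :
    i ∈ disagreement A ↔ ∃ π ∈ A, i ∈ symmDiff π πs := by
  rw [mem_disagreement]
  constructor
  · rintro ⟨⟨π, hπ, hi⟩, π', hπ', hi'⟩
    by_cases h : i ∈ πs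
    · exact ⟨π', hπ', Finset.mem_symmDiff.2 (Or.inr ⟨h, hi'⟩)⟩
    · exact ⟨π, hπ, Finset.mem_symmDiff.2 (Or.inl ⟨hi, h⟩)⟩
  · rintro ⟨π, hπ, hi⟩
    rcases Finset.mem_symmDiff.1 hi with ⟨h1, h2⟩ | ⟨h1, h2⟩
    · exact ⟨⟨π, hπ, h1⟩, πs, hs, h2⟩
    · exact ⟨⟨πs, hs, h1⟩, π, hπ, h2⟩

lemma signedIndicator_eq_zero {A : Finset (Finset (Fin n))} {π' π : Finset (Fin n)}
    (h' : π' ∈ A) (h : π ∈ A) {i : Fin n} (hi : i ∉ disagreement A) :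
    signedIndicator π' π i = 0 := by
  rw [mem_disagreement] at hi
  by_cases h1 : i ∈ π' <;> by_cases h2 : i ∈ π <;> simp only [signedIndicator, h1, h2] <;> norm_num
  · exact hi ⟨⟨_, h', h1⟩, _, h, h2⟩
  · exact hi ⟨⟨_, h, h2⟩, _, h', h1⟩

lemma eq_singleton_of_disagreement {A : Finset (Finset (Fin n))} (hs : πs ∈ A)
    (h : disagreement A = ∅) : A = {πs} := by
  refine Finset.eq_singleton_iff_unique_mem.2 ⟨hs, fun π hπ => ?_⟩
  by_contra hne
  obtain ⟨i, hi⟩ := Finset.card_pos.1 (symmDist_pos hne)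
  have : i ∈ disagreement A := (exists_mem_symmDiff hs).2 ⟨π, hπ, hi⟩
  simp [h] at this

/-- The difference of the total rewards of `π'` and `π` in an observation list. -/
def observedSum (obs : List (Fin n × ℝ)) (π' π : Finset (Fin n)) : ℝ :=
  (obs.map fun x => signedIndicator π' π x.1 * x.2).sum

lemma estimate_eq (t : ℕ) (obs : List (Fin n × ℝ)) (π' π : Finset (Fin n)) :
    estimate t obs π' π = (n : ℝ) / t * observedSum obs π' π := by
  rw [estimate]
  congr 1
  induction obs with
  | nil => simp [observedSum]
  | cons x l ih =>
    simp only [observedSum, List.map_cons, List.sum_cons] at ih ⊢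
    rw [← ih]
    by_cases h1 : x.1 ∈ π' <;> by_cases h2 : x.1 ∈ π <;>
      simp [signedIndicator, h1, h2] <;> ring

/-- The difference of the total rewards of `π'` and `π` if all draws were observed. -/
def drawnSum (I : ℕ → Fin n) (R : Fin n → ℕ → ℝ) (t : ℕ) (π' π : Finset (Fin n)) : ℝ :=
  ∑ s ∈ Finset.range t, signedIndicator π' π (I s) * R (I s) s

lemma drawnSum_swap (I : ℕ → Fin n) (R : Fin n → ℕ → ℝ) (t : ℕ) (π' π : Finset (Fin n)) :
    drawnSum I R t π' π = -drawnSum I R t π π' := by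
  rw [drawnSum, drawnSum, ← Finset.sum_neg_distrib]
  exact Finset.sum_congr rfl fun s _ => by rw [signedIndicator_swap]; ring

variable {I : ℕ → Fin n} {R : Fin n → ℕ → ℝ}

lemma mem_eliminate {C : Finset (Fin n) → Finset (Fin n) → ℕ → ℝ → ℝ} {t : ℕ} {ε : ℝ}
    {A : Finset (Finset (Fin n))} {obs : List (Fin n × ℝ)} {π : Finset (Fin n)} :
    π ∈ eliminate C t ε A obs ↔ π ∈ A ∧ ∀ π' ∈ A, estimate t obs π' π ≤ C π' π t ε := by
  simp [eliminate]

lemma run_succ_active_subset (C : Finset (Fin n) → Finset (Fin n) → ℕ → ℝ → ℝ) (t : ℕ) :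
    (run F C δ I R (t + 1)).active ⊆ (run F C δ I R t).active := by
  intro π hπ
  simp only [run, step] at hπ
  split_ifs at hπ
  all_goals first | exact hπ | exact (mem_eliminate.1 hπ).1

lemma run_active_subset (C : Finset (Fin n) → Finset (Fin n) → ℕ → ℝ → ℝ) (t : ℕ) :
    (run F C δ I R t).active ⊆ F := by
  induction t with
  | zero => exact subset_rfl
  | succ t ih => exact (run_succ_active_subset C t).trans ih

lemma run_succ_obs (C : Finset (Fin n) → Finset (Fin n) → ℕ → ℝ → ℝ) (t : ℕ) :
    (run F C δ I R (t + 1)).obs =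
      if I t ∈ disagreement (run F C δ I R t).active
      then (I t, R (I t) t) :: (run F C δ I R t).obs else (run F C δ I R t).obs := by
  simp only [run, step]
  split_ifs <;> rfl

/-- An unobserved item is one on which all active sets agree, so its signed indicator vanishes. The
pairs are those active before the elimination of iteration `t + 1`, which are the ones it compares.
-/
lemma observedSum_run_succ (C : Finset (Fin n) → Finset (Fin n) → ℕ → ℝ → ℝ) (t : ℕ) :
    ∀ π' ∈ (run F C δ I R t).active, ∀ π ∈ (run F C δ I R t).active,
      observedSum (run F C δ I R (t + 1)).obs π' π = drawnSum I R (t + 1) π' π := by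
  have key : ∀ t, (∀ π' ∈ (run F C δ I R t).active, ∀ π ∈ (run F C δ I R t).active,
      observedSum (run F C δ I R t).obs π' π = drawnSum I R t π' π) →
      ∀ π' ∈ (run F C δ I R t).active, ∀ π ∈ (run F C δ I R t).active,
      observedSum (run F C δ I R (t + 1)).obs π' π = drawnSum I R (t + 1) π' π := by
    intro t ih π' hπ' π hπ
    rw [run_succ_obs, drawnSum, Finset.sum_range_succ, ← drawnSum, ← ih π' hπ' π hπ]
    split_ifs with h
    · rw [observedSum, List.map_cons, List.sum_cons, ← observedSum, add_comm]
    · rw [signedIndicator_eq_zero hπ' hπ h]; ring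
  induction t with
  | zero => exact key 0 fun π' _ π _ => by simp [run, observedSum, drawnSum]
  | succ t ih =>
    exact key (t + 1) fun π' hπ' π hπ =>
      ih π' (run_succ_active_subset C t hπ') π (run_succ_active_subset C t hπ)

lemma observedSum_run (C : Finset (Fin n) → Finset (Fin n) → ℕ → ℝ → ℝ) (t : ℕ) :
    ∀ π' ∈ (run F C δ I R t).active, ∀ π ∈ (run F C δ I R t).active,
      observedSum (run F C δ I R t).obs π' π = drawnSum I R t π' π := by
  cases t with
  | zero => exact fun π' _ π _ => by simp [run, observedSum, drawnSum]
  | succ t =>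
    exact fun π' hπ' π hπ => observedSum_run_succ C t π' (run_succ_active_subset C t hπ') π
      (run_succ_active_subset C t hπ)

lemma length_obs_run (C : Finset (Fin n) → Finset (Fin n) → ℕ → ℝ → ℝ) (t : ℕ) :
    (run F C δ I R t).obs.length =
      ((Finset.range t).filter fun s => I s ∈ disagreement (run F C δ I R s).active).card := by
  induction t with
  | zero => simp [run]
  | succ t ih =>
    rw [run_succ_obs, Finset.range_add_one, Finset.filter_insert]
    split_ifs with h
    · rw [Finset.card_insert_of_notMem (by simp), List.length_cons, ih]
    · exact ih

/-- At the ends of all rounds up to time `T`, the estimated differences to `πs` are within the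
confidence widths of their expectations. -/
def Concentrated (F : Finset (Finset (Fin n))) (μ : Fin n → ℝ) (δ : ℝ) (πs : Finset (Fin n))
    (I : ℕ → Fin n) (R : Fin n → ℕ → ℝ) (T : ℕ) : Prop :=
  ∀ k : ℕ, 1 ≤ k → 2 ^ k ≤ T → ∀ π ∈ F, π ≠ πs →
    |(n : ℝ) / (2 ^ k : ℕ) * drawnSum I R (2 ^ k) π πs - (setMean μ π - setMean μ πs)|
      ≤ width F π πs (2 ^ k) (δ / (2 * (k : ℝ) ^ 2))

/-- No set beats `πs` by more than the width, since true differences to `πs` are negative. A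
surviving `π` is not beaten by `πs`, so its mean gap is at most one width from the test plus one
from concentration. The clause `t < 2 ^ round` turns the bound per round into one per draw. -/
lemma run_invariant (hμ : ∀ i, μ i ∈ Set.Icc (-1 : ℝ) 1) (hδ : 0 < δ) (hδ1 : δ < 1)
    (hs : πs ∈ F) (hbest : ∀ π ∈ F, π ≠ πs → setMean μ π < setMean μ πs) {T : ℕ}
    (hconc : Concentrated F μ δ πs I R T) {t : ℕ} (ht : t ≤ T) :
    πs ∈ (run F (width F) δ I R t).active ∧ 1 ≤ (run F (width F) δ I R t).round ∧
      t < 2 ^ (run F (width F) δ I R t).round ∧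
      ∀ π ∈ (run F (width F) δ I R t).active, π ≠ πs →
        (2 : ℝ) ^ (run F (width F) δ I R t).round ≤ 2816 * (n * tau F μ δ πs π) := by
  induction t with
  | zero =>
    refine ⟨hs, le_rfl, by simp [run], fun π hπ hne => ?_⟩
    have := half_le_mul_tau (F := F) hμ hδ hδ1 (hbest π hπ hne)
    simp only [run, pow_one]
    linarith
  | succ t ih =>
    obtain ⟨h1, h2, h3, h4⟩ := ih (by omega)
    have hsum := observedSum_run_succ (F := F) (δ := δ) (I := I) (R := R) (width F) t
    rw [run_succ_obs] at hsum
    have hF := run_active_subset (F := F) (δ := δ) (I := I) (R := R) (width F) t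
    simp only [run, step]
    set S := run F (width F) δ I R t
    split_ifs at hsum ⊢ with hk
    -- Away from the end of a round neither the active family nor the round changes. The cases left
    -- are those with `t + 1 = 2 ^ round`.
    all_goals try exact ⟨h1, h2, by simp only; omega, h4⟩
    all_goals
      have hest : ∀ π ∈ S.active, ∀ π' ∈ S.active, estimate (t + 1) _ π' π = _ :=
        fun π hπ π' hπ' => (estimate_eq _ _ _ _).trans (by rw [hsum π' hπ' π hπ])
      have hc := hconc S.round h2 (by omega)
      rw [← hk] at hc
      refine ⟨mem_eliminate.2 ⟨h1, fun π' hπ' => ?_⟩, by simp only; omega, ?_, fun π hπ hne => ?_⟩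
      · rw [hest _ h1 _ hπ']
        rcases eq_or_ne π' πs with rfl | hne
        · simp [drawnSum, signedIndicator, width_self]
        · have h5 := (abs_le.1 (hc π' (hF hπ') hne)).2
          have h6 := hbest π' (hF hπ') hne
          linarith
      · simp only [pow_succ]; omega
      · obtain ⟨hπ1, hπ2⟩ := mem_eliminate.1 hπ
        have h5 := hπ2 πs h1
        rw [hest _ hπ1 _ h1, drawnSum_swap, width_comm, mul_neg] at h5
        have h6 := (abs_le.1 (hc π (hF hπ1) hne)).2
        have h7 := hbest π (hF hπ1) hne
        refine pow_le_tau_of_le_width hμ hδ hδ1 h7 h2 ?_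
        rw [← hk]
        linarith

/-- If `π` is still active after `t` draws, then `t < 2816 n τ_π`. -/
lemma lt_of_mem_active (hμ : ∀ i, μ i ∈ Set.Icc (-1 : ℝ) 1) (hδ : 0 < δ) (hδ1 : δ < 1)
    (hs : πs ∈ F) (hbest : ∀ π ∈ F, π ≠ πs → setMean μ π < setMean μ πs) {T : ℕ}
    (hconc : Concentrated F μ δ πs I R T) {t : ℕ} (ht : t ≤ T) {π : Finset (Fin n)}
    (hπ : π ∈ (run F (width F) δ I R t).active) (hne : π ≠ πs) :
    (t : ℝ) < 2816 * (n * tau F μ δ πs π) := by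
  obtain ⟨-, -, h3, h4⟩ := run_invariant hμ hδ hδ1 hs hbest hconc ht
  exact lt_of_lt_of_le (by exact_mod_cast h3) (h4 π hπ hne)

/-- Removes the adaptivity: the right-hand side depends on each draw separately and not on the
history, so exponential moment bounds for the draws apply. -/
lemma length_obs_le (hμ : ∀ i, μ i ∈ Set.Icc (-1 : ℝ) 1) (hδ : 0 < δ) (hδ1 : δ < 1)
    (hs : πs ∈ F) (hbest : ∀ π ∈ F, π ≠ πs → setMean μ π < setMean μ πs) {T : ℕ}
    (hconc : Concentrated F μ δ πs I R T) {t : ℕ} (ht : t ≤ T) :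
    ((run F (width F) δ I R t).obs.length : ℝ)
      ≤ ∑ s ∈ Finset.range T, if (s : ℝ) < 2816 * (n * maxTau F μ δ πs (I s)) then 1 else 0 := by
  rw [length_obs_run, ← Finset.sum_filter, Finset.sum_const, nsmul_eq_mul, mul_one]
  norm_cast
  refine Finset.card_le_card fun s hsm => ?_
  obtain ⟨h1, h2⟩ := Finset.mem_filter.1 hsm
  have hst : s < t := Finset.mem_range.1 h1
  refine Finset.mem_filter.2 ⟨Finset.mem_range.2 (by omega), ?_⟩
  have hsT : s ≤ T := by omega
  obtain ⟨π, hπ, hi⟩ := (exists_mem_symmDiff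
    (run_invariant hμ hδ hδ1 hs hbest hconc hsT).1).1 h2
  refine (lt_of_mem_active hμ hδ hδ1 hs hbest hconc hsT hπ (ne_of_mem_symmDiff hi)).trans_le ?_
  gcongr
  exact tau_le_maxTau μ δ (run_active_subset _ _ hπ) hi

/-- Without replacement no item is observed twice. This bound is used when every relevant `maxTau`
is at least 1, where a Chernoff bound could lose an uncontrolled `log (2 / δ)`. -/
lemma length_obs_le_card (hs : πs ∈ F) (C : Finset (Fin n) → Finset (Fin n) → ℕ → ℝ → ℝ)
    (hinj : Function.Injective fun s : Fin n => I s) {t : ℕ} (ht : t ≤ n) :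
    (run F C δ I R t).obs.length ≤
      (Finset.univ.filter fun i => ∃ π ∈ F, i ∈ symmDiff π πs).card := by
  rw [length_obs_run]
  refine Finset.card_le_card_of_injOn I (fun s hsm => ?_) fun a ha b hb hab => ?_
  · have h2 := (Finset.mem_filter.1 (Finset.mem_coe.1 hsm)).2
    obtain ⟨⟨π, hπ, h3⟩, π', hπ', h4⟩ := mem_disagreement.1 h2
    have h5 : I s ∈ disagreement F := mem_disagreement.2
      ⟨⟨π, run_active_subset _ _ hπ, h3⟩, π', run_active_subset _ _ hπ', h4⟩
    exact Finset.mem_coe.2 (Finset.mem_filter.2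
      ⟨Finset.mem_univ _, (exists_mem_symmDiff hs).1 h5⟩)
  · have ha' := Finset.mem_range.1 (Finset.mem_filter.1 (Finset.mem_coe.1 ha)).1
    have hb' := Finset.mem_range.1 (Finset.mem_filter.1 (Finset.mem_coe.1 hb)).1
    have := @hinj ⟨a, by omega⟩ ⟨b, by omega⟩ hab
    simpa using this

/-! ### Stopping and output -/

lemma isOutput_iff_of_disagreement {S : State n} (hs : πs ∈ S.active)
    (h : disagreement S.active = ∅) (t : ℕ) (π' : Finset (Fin n)) :
    IsOutput t S π' ↔ π' = πs := by
  rw [IsOutput, eq_singleton_of_disagreement hs h]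
  constructor
  · exact fun h => Finset.mem_singleton.1 h.1
  · rintro rfl
    simp [estimate_eq, observedSum, signedIndicator]

lemma returnsWithin_of_stops {horizon : ℕ∞} {traj : ℕ → State n} {b : ℝ} {T : ℕ}
    (hfinal : Stops horizon T (traj T))
    (hout : ∀ t ≤ T, Stops horizon t (traj t) → ∀ π', IsOutput t (traj t) π' ↔ π' = πs)
    (hlen : ∀ t ≤ T, ((traj t).obs.length : ℝ) ≤ b) : ReturnsWithin horizon traj πs b := by
  classical
  have hex : ∃ t, Stops horizon t (traj t) := ⟨T, hfinal⟩
  have hle : Nat.find hex ≤ T := Nat.find_le hfinal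
  exact ⟨Nat.find hex, Nat.find_spec hex, fun s h => Nat.find_min hex h,
    hout _ hle (Nat.find_spec hex), hlen _ hle⟩

lemma returnsWithin_top (hμ : ∀ i, μ i ∈ Set.Icc (-1 : ℝ) 1) (hδ : 0 < δ) (hδ1 : δ < 1)
    (hs : πs ∈ F) (hbest : ∀ π ∈ F, π ≠ πs → setMean μ π < setMean μ πs) {T : ℕ}
    (hT : ∀ π ∈ F, π ≠ πs → 2816 * (n * tau F μ δ πs π) ≤ T)
    (hconc : Concentrated F μ δ πs I R T) {b : ℝ}
    (hlen : ∀ t ≤ T, ((run F (width F) δ I R t).obs.length : ℝ) ≤ b) :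
    ReturnsWithin ⊤ (run F (width F) δ I R) πs b := by
  refine returnsWithin_of_stops (T := T) (Or.inl ?_) (fun t ht hst => ?_) hlen
  · by_contra hne
    obtain ⟨i, hi⟩ := Finset.nonempty_iff_ne_empty.2 hne
    obtain ⟨π, hπ, hi⟩ := (exists_mem_symmDiff
      (run_invariant hμ hδ hδ1 hs hbest hconc le_rfl).1).1 hi
    have h1 := lt_of_mem_active hμ hδ hδ1 hs hbest hconc le_rfl hπ (ne_of_mem_symmDiff hi)
    exact absurd (hT π (run_active_subset _ _ hπ) (ne_of_mem_symmDiff hi)) h1.not_ge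
  · rcases hst with hst | hst
    · exact isOutput_iff_of_disagreement (run_invariant hμ hδ hδ1 hs hbest hconc ht).1 hst t
    · simp at hst

lemma drawnSum_of_injective (hinj : Function.Injective fun s : Fin n => I s)
    (π' π : Finset (Fin n)) :
    drawnSum I (fun i _ => μ i) n π' π = setMean μ π' - setMean μ π := by
  rw [setMean_sub, drawnSum,
    Finset.sum_range fun s => signedIndicator π' π (I s) * μ (I s)]
  exact (Equiv.ofBijective _ (Finite.injective_iff_bijective.1 hinj)).sum_comp
    fun i => signedIndicator π' π i * μ i

/-- If the horizon is reached, every item has been drawn once and the estimates between active sets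
are exact, so `πs` is the only output even when other sets are still active. -/
lemma returnsWithin_persistent (hμ : ∀ i, μ i ∈ Set.Icc (-1 : ℝ) 1) (hδ : 0 < δ) (hδ1 : δ < 1)
    (hs : πs ∈ F) (hbest : ∀ π ∈ F, π ≠ πs → setMean μ π < setMean μ πs) (hn : n ≠ 0)
    (hconc : Concentrated F μ δ πs I (fun i _ => μ i) n)
    (hinj : Function.Injective fun s : Fin n => I s) {b : ℝ}
    (hlen : ∀ t ≤ n, ((run F (width F) δ I (fun i _ => μ i) t).obs.length : ℝ) ≤ b) :
    ReturnsWithin n (run F (width F) δ I (fun i _ => μ i)) πs b := by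
  refine returnsWithin_of_stops (T := n) (Or.inr le_rfl) (fun t ht hst π' => ?_) hlen
  have hact := (run_invariant hμ hδ hδ1 hs hbest hconc ht).1
  rcases hst with hst | hst
  · exact isOutput_iff_of_disagreement hact hst t π'
  · obtain rfl : t = n := le_antisymm ht (by exact_mod_cast hst)
    have hn0 : (t : ℝ) ≠ 0 := by exact_mod_cast hn
    have hest : ∀ π' ∈ (run F (width F) δ I (fun i _ => μ i) t).active,
        ∀ π ∈ (run F (width F) δ I (fun i _ => μ i) t).active,
        estimate t (run F (width F) δ I (fun i _ => μ i) t).obs π' π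
          = setMean μ π' - setMean μ π := fun π' hπ' π hπ => by
      rw [estimate_eq, observedSum_run _ _ π' hπ' π hπ, drawnSum_of_injective hinj,
        div_self hn0, one_mul]
    constructor
    · rintro ⟨h1, h2⟩
      by_contra hne
      have h3 := h2 πs hact
      rw [hest _ h1 _ hact] at h3
      linarith [hbest π' (run_active_subset _ _ h1) hne]
    · rintro rfl
      refine ⟨hact, fun π hπ => ?_⟩
      rw [hest _ hact _ hπ]
      rcases eq_or_ne π π' with rfl | hne
      · simp
      · linarith [hbest π (run_active_subset _ _ hπ) hne]

end

end

section

variable {n : ℕ} {Ω : Type*} [MeasurableSpace Ω] {P : Measure Ω} [IsProbabilityMeasure P]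
  {I : ℕ → Ω → Fin n} {F : Finset (Finset (Fin n))} {μ : Fin n → ℝ} {δ : ℝ}
  {πs : Finset (Fin n)}

/-! ### Concentration at the ends of the rounds -/

/-- The total reward difference of `π'` and `π` after `t` draws satisfies Bernstein's bound on the
moment generating function. -/
structure BernsteinDraws (P : Measure Ω) (I : ℕ → Ω → Fin n) (R : Fin n → ℕ → Ω → ℝ)
    (μ : Fin n → ℝ) (t : ℕ) (π' π : Finset (Fin n)) : Prop where
  integrable : ∀ l : ℝ, 0 ≤ l →
    Integrable (fun ω => Real.exp (l * drawnSum (fun s => I s ω) (fun i s => R i s ω) t π' π)) P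
  mgf_le : ∀ l : ℝ, 0 ≤ l → l < 3 →
    mgf (fun ω => drawnSum (fun s => I s ω) (fun i s => R i s ω) t π' π) P l
      ≤ Real.exp (l * (t / n * (setMean μ π' - setMean μ π))
        + (t * symmDist π' π / n) * (l ^ 2 / (2 * (1 - l / 3))))

/-- Explains the constants of the width: it is Bernstein's `√(2vB) + B / 3` with `v = t d / n` and
`B = 4 V log (n / ε)`, rescaled from sums to estimates. -/
lemma scaled_width (F : Finset (Finset (Fin n))) (π' π : Finset (Fin n)) {t : ℕ} (ht : 0 < t)
    (hn : 0 < n) (ε : ℝ) :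
    (t : ℝ) / n * width F π' π t ε
      = Real.sqrt (2 * (t * symmDist π' π / n) * (4 * localVC F π' π * Real.log (n / ε)))
        + 4 * localVC F π' π * Real.log (n / ε) / 3 := by
  have ht' : (0 : ℝ) < t := by exact_mod_cast ht
  have hn' : (0 : ℝ) < n := by exact_mod_cast hn
  rw [width, mul_add]
  congr 1
  · rw [← Real.sqrt_sq (show (0 : ℝ) ≤ t / n by positivity), ← Real.sqrt_mul (by positivity)]
    congr 1
    field_simp
    ring
  · field_simp

lemma BernsteinDraws.tail {R : Fin n → ℕ → Ω → ℝ} {t : ℕ} {π' π : Finset (Fin n)}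
    (h : BernsteinDraws P I R μ t π' π) (ht : 0 < t) (hne : π' ≠ π) {ε : ℝ} (hε : 0 < ε)
    (hε1 : ε ≤ 1) :
    P.real {ω | width F π' π t ε < (n : ℝ) / t *
        drawnSum (fun s => I s ω) (fun i s => R i s ω) t π' π - (setMean μ π' - setMean μ π)}
      ≤ (ε / n) ^ (4 * localVC F π' π) := by
  have hn : 0 < n := one_le_of_ne hne
  have ht' : (0 : ℝ) < t := by exact_mod_cast ht
  have hn' : (0 : ℝ) < n := by exact_mod_cast hn
  have hn1 : (1 : ℝ) ≤ n := by exact_mod_cast hn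
  have hd : (0 : ℝ) < symmDist π' π := by exact_mod_cast symmDist_pos hne
  have hL : 0 ≤ Real.log (n / ε) := Real.log_nonneg (by rw [le_div_iff₀ hε]; linarith)
  have h1 := bernstein_tail (P := P) (v := t * symmDist π' π / n)
    (B := 4 * localVC F π' π * Real.log (n / ε)) (by positivity) (by positivity)
    h.integrable h.mgf_le
  rw [← scaled_width F π' π ht hn ε] at h1
  have h2 : Real.exp (-(4 * localVC F π' π * Real.log (n / ε)))
      = (ε / n) ^ (4 * localVC F π' π) := by
    rw [← Real.exp_log (show 0 < ε / n by positivity), ← Real.exp_nat_mul, ← inv_div (n : ℝ) ε,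
      Real.log_inv]
    push_cast
    congr 1
    ring
  rw [← h2]
  refine le_trans (measureReal_mono fun ω hω => ?_) h1
  simp only [Set.mem_ofPred_eq] at hω ⊢
  rw [← mul_add, ← le_div_iff₀' (by positivity)]
  have h3 : ∀ y : ℝ, y / (t / n) = n / t * y := fun y => by field_simp
  rw [h3]
  linarith

/-- Two-sided deviations cost at most `2 δ_k ^ 4 ≤ δ / (8 k ^ 2)` in round `k`, and `∑ 1 / k ^ 2 ≤
2`. -/
lemma measureReal_not_concentrated_le {R : Fin n → ℕ → Ω → ℝ} {T : ℕ} (hδ : 0 < δ) (hδ1 : δ < 1)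
    (h : ∀ t ≤ T, ∀ π' π, BernsteinDraws P I R μ t π' π) :
    P.real {ω | ¬ Concentrated F μ δ πs (fun s => I s ω) (fun i s => R i s ω) T} ≤ δ / 4 := by
  set E : ℕ → Finset (Fin n) → Finset (Fin n) → Set Ω := fun k π' π =>
    {ω | width F π' π (2 ^ k) (δ / (2 * (k : ℝ) ^ 2)) < (n : ℝ) / (2 ^ k : ℕ) *
        drawnSum (fun s => I s ω) (fun i s => R i s ω) (2 ^ k) π' π
          - (setMean μ π' - setMean μ π)} with hE
  set K : Finset ℕ := (Finset.Ioo 0 (T + 1)).filter fun k => 2 ^ k ≤ T with hK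
  have hsub : {ω | ¬ Concentrated F μ δ πs (fun s => I s ω) (fun i s => R i s ω) T}
      ⊆ ⋃ k ∈ K, ⋃ π ∈ F.erase πs, (E k π πs ∪ E k πs π) := by
    intro ω hω
    simp only [Set.mem_ofPred_eq, Concentrated, not_forall, not_le] at hω
    obtain ⟨k, hk1, hkT, π, hπ, hne, hlt⟩ := hω
    have hkK : k ∈ K := by
      have : k < 2 ^ k := Nat.lt_two_pow_self
      simp only [hK, Finset.mem_filter, Finset.mem_Ioo]
      omega
    refine Set.mem_biUnion hkK (Set.mem_biUnion (Finset.mem_erase.2 ⟨hne, hπ⟩) ?_)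
    rcases lt_abs.1 hlt with h1 | h1
    · exact Or.inl h1
    · right
      simp only [hE, Set.mem_ofPred_eq]
      rw [width_comm, drawnSum_swap]
      linarith
  have hsum : ∀ k ∈ K, ∑ π ∈ F.erase πs, P.real (E k π πs ∪ E k πs π)
      ≤ δ / 8 * ((k : ℝ) ^ 2)⁻¹ := by
    intro k hk
    obtain ⟨hk0, hkT⟩ := Finset.mem_filter.1 hk
    have hk1 : 1 ≤ k := (Finset.mem_Ioo.1 hk0).1
    have hk1' : (1 : ℝ) ≤ k := by exact_mod_cast hk1
    have hk2 : (1 : ℝ) ≤ (k : ℝ) ^ 2 := one_le_pow₀ hk1'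
    have hε : 0 < δ / (2 * (k : ℝ) ^ 2) := by positivity
    have hε1 : δ / (2 * (k : ℝ) ^ 2) ≤ 1 := by
      rw [div_le_one (by positivity)]; linarith
    have h1 : ∀ π ∈ F.erase πs, P.real (E k π πs ∪ E k πs π)
        ≤ 2 * (δ / (2 * (k : ℝ) ^ 2) / n) ^ (4 * localVC F π πs) := by
      intro π hπ
      have hne := Finset.ne_of_mem_erase hπ
      have h2 := (h _ hkT π πs).tail (F := F) (by positivity) hne hε hε1
      have h3 := (h _ hkT πs π).tail (F := F) (by positivity) hne.symm hε hε1
      rw [localVC_comm] at h3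
      refine (measureReal_union_le _ _).trans ?_
      rw [two_mul]
      exact add_le_add h2 h3
    refine (Finset.sum_le_sum h1).trans ?_
    rw [← Finset.mul_sum]
    refine (mul_le_mul_of_nonneg_left (sum_pow_localVC_le F πs hε.le hε1) (by norm_num)).trans ?_
    have h4 : δ ^ 4 ≤ δ := by
      calc δ ^ 4 ≤ δ ^ 1 := pow_le_pow_of_le_one hδ.le hδ1.le (by norm_num)
        _ = δ := pow_one δ
    have h5 : 2 * (δ / (2 * (k : ℝ) ^ 2)) ^ 4 = δ ^ 4 / 8 * (((k : ℝ) ^ 2)⁻¹) ^ 4 := by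
      field_simp; norm_num
    have h6 : (((k : ℝ) ^ 2)⁻¹) ^ 4 ≤ ((k : ℝ) ^ 2)⁻¹ := by
      calc (((k : ℝ) ^ 2)⁻¹) ^ 4 ≤ (((k : ℝ) ^ 2)⁻¹) ^ 1 :=
            pow_le_pow_of_le_one (by positivity) (inv_le_one_of_one_le₀ hk2) (by norm_num)
        _ = _ := pow_one _
    rw [h5]
    gcongr
  calc P.real {ω | ¬ Concentrated F μ δ πs (fun s => I s ω) (fun i s => R i s ω) T}
      ≤ P.real (⋃ k ∈ K, ⋃ π ∈ F.erase πs, (E k π πs ∪ E k πs π)) :=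
        measureReal_mono hsub (measure_ne_top _ _)
    _ ≤ ∑ k ∈ K, P.real (⋃ π ∈ F.erase πs, (E k π πs ∪ E k πs π)) :=
        measureReal_biUnion_finset_le _ _
    _ ≤ ∑ k ∈ K, ∑ π ∈ F.erase πs, P.real (E k π πs ∪ E k πs π) :=
        Finset.sum_le_sum fun k _ => measureReal_biUnion_finset_le _ _
    _ ≤ ∑ k ∈ K, δ / 8 * ((k : ℝ) ^ 2)⁻¹ := Finset.sum_le_sum hsum
    _ ≤ ∑ k ∈ Finset.Ioo 0 (T + 1), δ / 8 * ((k : ℝ) ^ 2)⁻¹ :=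
        Finset.sum_le_sum_of_subset_of_nonneg (Finset.filter_subset _ _)
          fun k _ _ => by positivity
    _ ≤ δ / 8 * (2 / ((0 : ℕ) + 1)) := by
        rw [← Finset.mul_sum]
        exact mul_le_mul_of_nonneg_left (sum_Ioo_inv_sq_le 0 (T + 1)) (by positivity)
    _ = δ / 4 := by norm_num; ring

/-! ### The number of samples -/

lemma exp_indicator_mean_le {p : Fin n → ℝ} (hn : 0 < n) (hp : ∀ i, p i = 0 ∨ p i = 1) :
    (1 / (n : ℝ)) * ∑ i, Real.exp (p i) ≤ Real.exp (2 * ((1 / (n : ℝ)) * ∑ i, p i)) := by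
  have hn' : (0 : ℝ) < n := by exact_mod_cast hn
  have h1 : ∀ i, Real.exp (p i) ≤ 1 + 2 * p i := by
    intro i
    rcases hp i with h | h <;> rw [h]
    · simp
    · linarith [Real.exp_one_lt_d9]
  have h2 : ∑ i, Real.exp (p i) ≤ n + 2 * ∑ i, p i := by
    refine (Finset.sum_le_sum fun i _ => h1 i).trans_eq ?_
    simp [Finset.sum_add_distrib, Finset.mul_sum]
  calc (1 / (n : ℝ)) * ∑ i, Real.exp (p i) ≤ (1 / (n : ℝ)) * (n + 2 * ∑ i, p i) := by gcongr
    _ = 2 * ((1 / (n : ℝ)) * ∑ i, p i) + 1 := by field_simp; ring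
    _ ≤ _ := Real.add_one_le_exp _

/-- Chernoff's bound at parameter 1, where `e < 3` bounds the exponential moment by `exp` of twice
the mean. -/
lemma count_tail (hn : 0 < n) (hδ : 0 < δ) (hI : ∀ t, Measurable (I t)) {T : ℕ}
    {p : ℕ → Fin n → ℝ} (hp : ∀ s i, p s i = 0 ∨ p s i = 1)
    (hprod : ∫ ω, ∏ s ∈ Finset.range T, Real.exp (p s (I s ω)) ∂P
      ≤ ∏ s ∈ Finset.range T, ((1 / (n : ℝ)) * ∑ i, Real.exp (p s i))) :
    P.real {ω | 2 * ∑ s ∈ Finset.range T, (1 / (n : ℝ)) * ∑ i, p s i + Real.log (2 / δ)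
      ≤ ∑ s ∈ Finset.range T, p s (I s ω)} ≤ δ / 2 := by
  set m := ∑ s ∈ Finset.range T, (1 / (n : ℝ)) * ∑ i, p s i
  have hmeas : Measurable fun ω => ∑ s ∈ Finset.range T, p s (I s ω) :=
    Finset.measurable_sum _ fun s _ => (measurable_of_finite (p s)).comp (hI s)
  have hbd : ∀ ω, ∑ s ∈ Finset.range T, p s (I s ω) ≤ T := fun ω => by
    refine (Finset.sum_le_card_nsmul _ _ 1 fun s _ => ?_).trans_eq (by simp)
    rcases hp s (I s ω) with h | h <;> rw [h]
    exact zero_le_one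
  have hint : Integrable (fun ω => Real.exp (1 * ∑ s ∈ Finset.range T, p s (I s ω))) P := by
    refine Integrable.of_bound (hmeas.const_mul 1).exp.aestronglyMeasurable (Real.exp T)
      (Filter.Eventually.of_forall fun ω => ?_)
    rw [Real.norm_of_nonneg (Real.exp_pos _).le, one_mul]
    exact Real.exp_le_exp.2 (hbd ω)
  refine (measure_ge_le_exp_mul_mgf _ zero_le_one hint).trans ?_
  have hmgf : mgf (fun ω => ∑ s ∈ Finset.range T, p s (I s ω)) P 1 ≤ Real.exp (2 * m) := by
    simp only [mgf, one_mul, Real.exp_sum]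
    refine hprod.trans ?_
    rw [Finset.mul_sum, Real.exp_sum]
    exact Finset.prod_le_prod (fun s _ => mul_nonneg (by positivity)
      (Finset.sum_nonneg fun i _ => (Real.exp_pos _).le))
      fun s _ => exp_indicator_mean_le hn (hp s)
  refine (mul_le_mul_of_nonneg_left hmgf (Real.exp_pos _).le).trans_eq ?_
  rw [← Real.exp_add, show -1 * (2 * m + Real.log (2 / δ)) + 2 * m = -Real.log (2 / δ) by ring,
    Real.exp_neg, Real.exp_log (by positivity), inv_div]

/-- The indicator that item `i`, if drawn in iteration `s + 1`, may still be sampled. -/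
noncomputable def mayBeSampled (F : Finset (Finset (Fin n))) (μ : Fin n → ℝ) (δ : ℝ) (πs : Finset (Fin n))
    (s : ℕ) (i : Fin n) : ℝ :=
  if (s : ℝ) < 2816 * (n * maxTau F μ δ πs i) then 1 else 0

lemma mayBeSampled_eq (s : ℕ) (i : Fin n) :
    mayBeSampled F μ δ πs s i = 0 ∨ mayBeSampled F μ δ πs s i = 1 := by
  unfold mayBeSampled; split_ifs <;> simp

/-- Item `i` can be sampled only at the first `⌈2816 n maxTau⌉` times, each with chance `1 / n`.
Rounding up costs less than `1 ≤ 2 n maxTau`, hence 2818. For `T = n` the first entry of the minimum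
becomes 1. -/
lemma sum_mayBeSampled_le (hμ : ∀ i, μ i ∈ Set.Icc (-1 : ℝ) 1) (hδ : 0 < δ) (hδ1 : δ < 1)
    (hbest : ∀ π ∈ F, π ≠ πs → setMean μ π < setMean μ πs) (T : ℕ) (i : Fin n) :
    (1 / (n : ℝ)) * ∑ s ∈ Finset.range T, mayBeSampled F μ δ πs s i
      ≤ min (T / n : ℝ) (2818 * maxTau F μ δ πs i) := by
  have hn : (0 : ℝ) < n := by exact_mod_cast i.pos
  have hsum : ∑ s ∈ Finset.range T, mayBeSampled F μ δ πs s i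
      = (((Finset.range T).filter fun s : ℕ =>
        (s : ℝ) < 2816 * (n * maxTau F μ δ πs i)).card : ℝ) := by
    simp only [mayBeSampled]
    rw [← Finset.sum_filter, Finset.sum_const, nsmul_eq_mul, mul_one]
  rw [hsum, one_div, inv_mul_eq_div]
  refine le_min ?_ ?_
  · gcongr
    exact (Finset.card_filter_le _ _).trans_eq (Finset.card_range T)
  · rw [div_le_iff₀ hn]
    by_cases hex : ∃ π ∈ F, i ∈ symmDiff π πs
    · obtain ⟨π, hπ, hi, he⟩ := exists_maxTau_eq (μ := μ) (δ := δ) hex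
      have h1 := half_le_mul_tau (F := F) hμ hδ hδ1 (hbest π hπ (ne_of_mem_symmDiff hi))
      rw [← he] at h1
      have h2 : ((Finset.range T).filter fun s : ℕ =>
          (s : ℝ) < 2816 * (n * maxTau F μ δ πs i)).card
          ≤ ⌈2816 * (n * maxTau F μ δ πs i)⌉₊ := by
        rw [← Finset.card_range ⌈2816 * (n * maxTau F μ δ πs i)⌉₊]
        refine Finset.card_le_card fun s hs => ?_
        exact Finset.mem_range.2 (Nat.lt_ceil.2 (Finset.mem_filter.1 hs).2)
      have h3 := Nat.ceil_lt_add_one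
        (show 0 ≤ 2816 * (n * maxTau F μ δ πs i) by linarith)
      have h4 : (((Finset.range T).filter fun s : ℕ =>
          (s : ℝ) < 2816 * (n * maxTau F μ δ πs i)).card : ℝ)
          ≤ ⌈2816 * (n * maxTau F μ δ πs i)⌉₊ := by exact_mod_cast h2
      linarith
    · simp only [maxTau_eq_zero hex, mul_zero, zero_mul]
      rw [Finset.filter_false_of_mem fun s _ => not_lt.2 (Nat.cast_nonneg s)]
      simp

lemma expected_count_le (hμ : ∀ i, μ i ∈ Set.Icc (-1 : ℝ) 1) (hδ : 0 < δ) (hδ1 : δ < 1)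
    (hbest : ∀ π ∈ F, π ≠ πs → setMean μ π < setMean μ πs) (T : ℕ) :
    ∑ s ∈ Finset.range T, (1 / (n : ℝ)) * ∑ i, mayBeSampled F μ δ πs s i
      ≤ ∑ i, min (T / n : ℝ) (2818 * maxTau F μ δ πs i) := by
  rw [← Finset.mul_sum, Finset.sum_comm, Finset.mul_sum]
  exact Finset.sum_le_sum fun i _ => sum_mayBeSampled_le hμ hδ hδ1 hbest T i

lemma log_two_div_le_sum {π : Finset (Fin n)} {g : Fin n → ℝ}
    (hμ : ∀ i, μ i ∈ Set.Icc (-1 : ℝ) 1) (hδ : 0 < δ) (hδ1 : δ < 1)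
    (hlt : setMean μ π < setMean μ πs) (hg : ∀ i, 0 ≤ g i)
    (h : ∀ i ∈ symmDiff π πs, tau F μ δ πs π ≤ g i) : Real.log (2 / δ) ≤ ∑ i, g i := by
  refine (log_two_div_le_tau (F := F) hμ hδ hδ1 hlt).trans ?_
  rw [symmDist, ← nsmul_eq_mul]
  exact (Finset.card_nsmul_le_sum _ _ _ h).trans
    (Finset.sum_le_sum_of_subset_of_nonneg (Finset.subset_univ _) fun i _ _ => hg i)

/-! ### Assembling the guarantees -/

/-- Subadditivity alone is used, so the success event need not be shown measurable; the spare `δ /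
4` makes the inequality strict. -/
lemma lt_measureReal_of_union_eq_univ {A B C : Set Ω} (hδ : 0 < δ) (hB : P.real B ≤ δ / 4)
    (hC : P.real C ≤ δ / 2) (h : ∀ ω, ω ∉ B → ω ∉ C → ω ∈ A) : 1 - δ < P.real A := by
  have h1 : P.real (A ∪ (B ∪ C)) = 1 := by
    have : A ∪ (B ∪ C) = Set.univ := Set.eq_univ_of_forall fun ω => by
      by_cases hb : ω ∈ B
      · exact Or.inr (Or.inl hb)
      · by_cases hc : ω ∈ C
        · exact Or.inr (Or.inr hc)
        · exact Or.inl (h ω hb hc)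
    rw [this, probReal_univ]
  have h2 := measureReal_union_le (μ := P) A (B ∪ C)
  have h3 := measureReal_union_le (μ := P) B C
  linarith

lemma stochasticGuarantee_of_bernstein {R : Fin n → ℕ → Ω → ℝ}
    (hμ : ∀ i, μ i ∈ Set.Icc (-1 : ℝ) 1) (hδ : 0 < δ) (hδ1 : δ < 1) (hs : πs ∈ F)
    (hbest : ∀ π ∈ F, π ≠ πs → setMean μ π < setMean μ πs) (hn : 0 < n)
    (hI : ∀ t, Measurable (I t))
    (hprod : ∀ (T : ℕ) (f : ℕ → Fin n → ℝ),
      ∫ ω, ∏ s ∈ Finset.range T, f s (I s ω) ∂P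
        ≤ ∏ s ∈ Finset.range T, ((1 / (n : ℝ)) * ∑ i, f s i))
    (hbern : ∀ t π' π, BernsteinDraws P I R μ t π' π) :
    StochasticGuarantee 5637 F πs μ δ P I R := by
  -- A deterministic time by which only `πs` is left on the good event. The constant is `5637 = 2 *
  -- 2818 + 1`: twice the mean count plus the absorbed `log (2 / δ)`.
  obtain ⟨T, hT⟩ : ∃ T : ℕ, ∀ π ∈ F, π ≠ πs → 2816 * (n * tau F μ δ πs π) ≤ T := by
    obtain ⟨T, hT⟩ := exists_nat_ge (∑ π ∈ F, |2816 * (n * tau F μ δ πs π)|)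
    exact ⟨T, fun π hπ _ => (le_abs_self _).trans ((Finset.single_le_sum
      (f := fun π => |2816 * (n * tau F μ δ πs π)|) (fun _ _ => abs_nonneg _) hπ).trans hT)⟩
  refine lt_measureReal_of_union_eq_univ hδ
    (measureReal_not_concentrated_le (F := F) (πs := πs) (T := T) hδ hδ1
      fun t _ π' π => hbern t π' π)
    (count_tail hn hδ hI (T := T) (mayBeSampled_eq (F := F) (μ := μ) (δ := δ) (πs := πs))
      (hprod T fun s i => Real.exp (mayBeSampled F μ δ πs s i))) fun ω h1 h2 => ?_
  simp only [Set.mem_ofPred_eq, not_not, not_le] at h1 h2 ⊢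
  refine returnsWithin_top hμ hδ hδ1 hs hbest hT h1 fun t ht => ?_
  refine (length_obs_le hμ hδ hδ1 hs hbest h1 ht).trans ?_
  have hnn := maxTau_nonneg (F := F) (πs := πs) hμ hδ hδ1 hbest
  by_cases hex : ∃ π ∈ F, π ≠ πs
  · obtain ⟨π, hπ, hne⟩ := hex
    have h3 := expected_count_le (F := F) (πs := πs) hμ hδ hδ1 hbest T
    have h4 : ∑ i, min (T / n : ℝ) (2818 * maxTau F μ δ πs i)
        ≤ 2818 * ∑ i, maxTau F μ δ πs i := by
      rw [Finset.mul_sum]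
      exact Finset.sum_le_sum fun i _ => min_le_right _ _
    have h5 := log_two_div_le_sum (F := F) hμ hδ hδ1 (hbest π hπ hne) hnn
      fun i hi => tau_le_maxTau μ δ hπ hi
    refine h2.le.trans ?_
    linarith
  · have hz : ∀ i, maxTau F μ δ πs i = 0 := fun i => maxTau_eq_zero fun ⟨π, hπ, hi⟩ =>
      hex ⟨π, hπ, ne_of_mem_symmDiff hi⟩
    simp [hz, not_lt.2 (Nat.cast_nonneg _)]

lemma persistentGuarantee_of_bernstein
    (hμ : ∀ i, μ i ∈ Set.Icc (-1 : ℝ) 1) (hδ : 0 < δ) (hδ1 : δ < 1) (hs : πs ∈ F)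
    (hbest : ∀ π ∈ F, π ≠ πs → setMean μ π < setMean μ πs) (hn : 0 < n)
    (hI : SamplingWithoutReplacement P I)
    (hbern : ∀ t ≤ n, ∀ π' π, BernsteinDraws P I (fun i _ _ => μ i) μ t π' π) :
    PersistentGuarantee 5637 F πs μ δ P I := by
  -- At every time the indicator is a nondecreasing function of `maxTau`, so all of them are
  -- similarly ordered, as the permutation inequality requires.
  have hmono : ∀ (s t : ℕ) (a b : Fin n),
      0 ≤ (Real.exp (mayBeSampled F μ δ πs s a) - Real.exp (mayBeSampled F μ δ πs s b))
        * (Real.exp (mayBeSampled F μ δ πs t a) - Real.exp (mayBeSampled F μ δ πs t b)) := by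
    intro s t a b
    have h : ∀ (a b : Fin n), maxTau F μ δ πs a ≤ maxTau F μ δ πs b → ∀ s : ℕ,
        Real.exp (mayBeSampled F μ δ πs s a) ≤ Real.exp (mayBeSampled F μ δ πs s b) := by
      intro a b hab s
      refine Real.exp_le_exp.2 ?_
      have h1 : 2816 * ((n : ℝ) * maxTau F μ δ πs a) ≤ 2816 * (n * maxTau F μ δ πs b) := by
        gcongr
      unfold mayBeSampled
      split_ifs <;> first | (exfalso; linarith) | norm_num
    rcases le_total (maxTau F μ δ πs a) (maxTau F μ δ πs b) with hab | hab
    · exact mul_nonneg_of_nonpos_of_nonpos (by linarith [h a b hab s]) (by linarith [h a b hab t])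
    · exact mul_nonneg (by linarith [h b a hab s]) (by linarith [h b a hab t])
  refine lt_measureReal_of_union_eq_univ hδ
    (B := {ω | ¬ Concentrated F μ δ πs (fun s => I s ω) (fun i s => μ i) n} ∪
      {ω | ¬ Function.Injective fun s : Fin n => I s ω})
    ((measureReal_union_le _ _).trans (by
      rw [hI.ae_injective, add_zero]
      exact measureReal_not_concentrated_le (F := F) (πs := πs) (T := n) hδ hδ1 hbern))
    (count_tail hn hδ hI.measurable_draw (T := n)
      (mayBeSampled_eq (F := F) (μ := μ) (δ := δ) (πs := πs))
      (hI.integral_prod_le le_rfl (f := fun s i => Real.exp (mayBeSampled F μ δ πs s i))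
        (fun _ _ => (Real.exp_pos _).le) hmono)) fun ω h1 h2 => ?_
  simp only [Set.mem_union, not_or, Set.mem_ofPred_eq, not_not, not_le] at h1 h2 ⊢
  obtain ⟨h1, hinj⟩ := h1
  refine returnsWithin_persistent hμ hδ hδ1 hs hbest hn.ne' h1 hinj fun t ht => ?_
  have hnn := maxTau_nonneg (F := F) (πs := πs) hμ hδ hδ1 hbest
  have hmin : ∀ i, 0 ≤ min 1 (maxTau F μ δ πs i) := fun i => le_min zero_le_one (hnn i)
  -- If some relevant `maxTau` is below 1, the set attaining it has `τ_π < 1`, so truncation at 1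
  -- does not spoil the absorption of `log (2 / δ)`. Otherwise each relevant item contributes 1 to
  -- the bound, and counting distinct items suffices.
  by_cases hex : ∃ i, (∃ π ∈ F, i ∈ symmDiff π πs) ∧ maxTau F μ δ πs i < 1
  · refine (length_obs_le hμ hδ hδ1 hs hbest h1 ht).trans ?_
    obtain ⟨i, hi, hlt⟩ := hex
    obtain ⟨π, hπ, hi, he⟩ := exists_maxTau_eq (μ := μ) (δ := δ) hi
    have h3 := expected_count_le (F := F) (πs := πs) hμ hδ hδ1 hbest n
    have h4 : ∑ i, min (n / n : ℝ) (2818 * maxTau F μ δ πs i)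
        ≤ 2818 * ∑ i, min 1 (maxTau F μ δ πs i) := by
      rw [Finset.mul_sum, div_self (by exact_mod_cast hn.ne')]
      refine Finset.sum_le_sum fun i _ => ?_
      rw [mul_min_of_nonneg _ _ (by norm_num)]
      exact min_le_min_right _ (by norm_num)
    have h5 := log_two_div_le_sum (F := F) hμ hδ hδ1 (hbest π hπ (ne_of_mem_symmDiff hi)) hmin
      fun i hi => le_min (he ▸ hlt.le) (tau_le_maxTau μ δ hπ hi)
    refine h2.le.trans ?_
    linarith
  · have h3 : ((run F (width F) δ (fun s => I s ω) (fun i _ => μ i) t).obs.length : ℝ)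
        ≤ ((Finset.univ.filter fun i => ∃ π ∈ F, i ∈ symmDiff π πs).card : ℝ) := by
      exact_mod_cast length_obs_le_card hs _ hinj ht
    refine h3.trans ?_
    have h4 : ((Finset.univ.filter fun i => ∃ π ∈ F, i ∈ symmDiff π πs).card : ℝ)
        ≤ ∑ i, min 1 (maxTau F μ δ πs i) := by
      rw [← nsmul_one]
      refine (Finset.card_nsmul_le_sum _ _ _ fun i hi => ?_).trans
        (Finset.sum_le_sum_of_subset_of_nonneg (Finset.subset_univ _) fun i _ _ => hmin i)
      refine le_min le_rfl (not_lt.1 fun hlt => hex ⟨i, (Finset.mem_filter.1 hi).2, hlt⟩)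
    have h5 : 0 ≤ ∑ i, min 1 (maxTau F μ δ πs i) := Finset.sum_nonneg fun i _ => hmin i
    linarith

end

section

variable {n : ℕ} {Ω : Type*} [MeasurableSpace Ω] {P : Measure Ω} [IsProbabilityMeasure P]
  {I : ℕ → Ω → Fin n} {F : Finset (Finset (Fin n))} {μ : Fin n → ℝ} {δ : ℝ}
  {πs : Finset (Fin n)}

/-! ### The two sampling models satisfy Bernstein's bound -/

lemma measurable_reward (π' π : Finset (Fin n)) :
    Measurable fun x : Fin n × (Fin n → ℝ) => signedIndicator π' π x.1 * x.2 x.1 := by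
  refine measurable_from_prod_countable_right fun i => ?_
  exact (measurable_pi_apply (X := fun _ : Fin n => ℝ) i).const_mul (signedIndicator π' π i)

lemma integrable_exp_of_abs_le {X : Ω → ℝ} {C : ℝ} (hX : Measurable X) (hC : ∀ᵐ ω ∂P, |X ω| ≤ C)
    {l : ℝ} (hl : 0 ≤ l) : Integrable (fun ω => Real.exp (l * X ω)) P := by
  refine Integrable.of_bound (hX.const_mul l).exp.aestronglyMeasurable (Real.exp (l * C)) ?_
  filter_upwards [hC] with ω hω
  rw [Real.norm_of_nonneg (Real.exp_pos _).le]
  exact Real.exp_le_exp.2 (mul_le_mul_of_nonneg_left ((le_abs_self _).trans hω) hl)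

lemma measurable_drawnSum {R : Fin n → ℕ → Ω → ℝ} (hI : ∀ t, Measurable (I t))
    (hR : ∀ i t, Measurable (R i t)) (t : ℕ) (π' π : Finset (Fin n)) :
    Measurable fun ω => drawnSum (fun s => I s ω) (fun i s => R i s ω) t π' π :=
  Finset.measurable_sum _ fun s _ => (measurable_reward π' π).comp
    ((hI s).prodMk (measurable_pi_iff.2 fun i => hR i s))

lemma abs_drawnSum_le {J : ℕ → Fin n} {r : Fin n → ℕ → ℝ} (hr : ∀ i s, |r i s| ≤ 1) (t : ℕ)
    (π' π : Finset (Fin n)) : |drawnSum J r t π' π| ≤ t := by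
  refine (Finset.abs_sum_le_sum_abs _ _).trans ((Finset.sum_le_card_nsmul _ _ 1 fun s _ => ?_).trans
    (by simp))
  rw [abs_mul]
  exact mul_le_one₀ (abs_signedIndicator_le _ _ _) (abs_nonneg _) (hr _ _)

lemma pow_mean_le_exp {x m c d t l N : ℝ} {k : ℕ} (hk : (k : ℝ) = t) (hx : 0 ≤ x)
    (h : x ≤ 1 + l * (1 / N * m) + d / N * c) :
    x ^ k ≤ Real.exp (l * (t / N * m) + t * d / N * c) := by
  have h1 : x ≤ Real.exp (l * (1 / N * m) + d / N * c) :=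
    h.trans (by linarith [Real.add_one_le_exp (l * (1 / N * m) + d / N * c)])
  refine (pow_le_pow_left₀ hx h1 k).trans_eq ?_
  rw [← Real.exp_nat_mul, hk]
  congr 1
  ring

/-- The same function of the item is used at each time, so the ordering condition is the
nonnegativity of a square, and one uniform draw determines the bound. -/
lemma SamplingWithoutReplacement.bernsteinDraws (hI : SamplingWithoutReplacement P I)
    (hμ : ∀ i, μ i ∈ Set.Icc (-1 : ℝ) 1) (hn : 0 < n) {t : ℕ} (ht : t ≤ n)
    (π' π : Finset (Fin n)) : BernsteinDraws P I (fun i _ _ => μ i) μ t π' π where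
  integrable l hl := integrable_exp_of_abs_le
    (measurable_drawnSum hI.measurable_draw (fun _ _ => measurable_const) t π' π)
    (Filter.Eventually.of_forall fun ω => abs_drawnSum_le (fun i _ => abs_le.2 (hμ i)) t π' π) hl
  mgf_le l hl hl3 := by
    have hn' : (0 : ℝ) < n := by exact_mod_cast hn
    simp only [mgf, drawnSum, Finset.mul_sum, Real.exp_sum]
    refine (hI.integral_prod_le ht
      (f := fun _ i => Real.exp (l * (signedIndicator π' π i * μ i)))
      (fun _ _ => (Real.exp_pos _).le) (fun _ _ _ _ => mul_self_nonneg _)).trans ?_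
    rw [Finset.prod_const, Finset.card_range]
    refine pow_mean_le_exp rfl (mul_nonneg (by positivity)
      (Finset.sum_nonneg fun i _ => (Real.exp_pos _).le)) ?_
    set c := l ^ 2 / (2 * (1 - l / 3))
    have hc : 0 ≤ c := div_nonneg (sq_nonneg _) (by linarith)
    have h1 : ∀ i, Real.exp (l * (signedIndicator π' π i * μ i))
        ≤ 1 + l * (signedIndicator π' π i * μ i) + signedIndicator π' π i ^ 2 * c := by
      intro i
      have hμi : |μ i| ≤ 1 := abs_le.2 (hμ i)
      refine (exp_mul_le_quadratic ?_ hl hl3).trans ?_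
      · rw [abs_mul]
        exact mul_le_one₀ (abs_signedIndicator_le _ _ _) (abs_nonneg _) hμi
      · rw [mul_pow]
        gcongr
        refine mul_le_of_le_one_right (sq_nonneg _) ?_
        rw [← sq_abs]
        exact pow_le_one₀ (abs_nonneg _) hμi
    have h2 := Finset.sum_le_sum fun i (_ : i ∈ Finset.univ) => h1 i
    rw [Finset.sum_add_distrib, Finset.sum_add_distrib, ← Finset.mul_sum, ← Finset.sum_mul,
      sum_signedIndicator_sq, ← setMean_sub] at h2
    simp only [Finset.sum_const, Finset.card_univ, Fintype.card_fin, nsmul_eq_mul, mul_one] at h2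
    rw [one_div, inv_mul_le_iff₀ hn']
    refine h2.trans_eq ?_
    field_simp

namespace StochasticSampling

variable {R : Fin n → ℕ → Ω → ℝ}

lemma integral_draw (hS : StochasticSampling P I R) (t : ℕ) (f : Fin n → ℝ) :
    ∫ ω, f (I t ω) ∂P = (1 / (n : ℝ)) * ∑ i, f i := by
  have : IsProbabilityMeasure (P.map (I t)) :=
    Measure.isProbabilityMeasure_map (hS.measurable_draw t).aemeasurable
  rw [← integral_map (f := f) (hS.measurable_draw t).aemeasurable
    (measurable_of_finite f).aestronglyMeasurable, integral_fintype Integrable.of_finite,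
    Finset.mul_sum]
  refine Finset.sum_congr rfl fun i _ => ?_
  rw [map_measureReal_apply (hS.measurable_draw t) (measurableSet_singleton i), smul_eq_mul,
    ← hS.uniform t i]
  rfl

lemma integral_prod_draws (hS : StochasticSampling P I R) (T : ℕ) (f : ℕ → Fin n → ℝ) :
    ∫ ω, ∏ s ∈ Finset.range T, f s (I s ω) ∂P
      = ∏ s ∈ Finset.range T, ((1 / (n : ℝ)) * ∑ i, f s i) := by
  have h := hS.indep_rounds.comp (fun s x => f s x.1)
    fun s => (measurable_of_finite (f s)).comp measurable_fst
  have h2 := (h.precomp (g := fun s : Fin T => (s : ℕ)) Fin.val_injective).integral_prod_eq_prod_integral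
    fun s => ((measurable_of_finite (f s)).comp (hS.measurable_draw s)).aestronglyMeasurable
  simp only [Finset.prod_apply, Function.comp_apply] at h2
  rw [Finset.prod_range fun s => (1 / (n : ℝ)) * ∑ i, f s i,
    Finset.prod_congr rfl fun (s : Fin T) _ => (hS.integral_draw s (f s)).symm, ← h2]
  simp only [Finset.prod_range]

/-- Splitting by the value of the draw leaves products of a function of `I t` with a single `R i t`,
so no independence between items is needed. -/
lemma integral_reward (hS : StochasticSampling P I R)
    (hR : ∀ i t, ∀ᵐ ω ∂P, R i t ω ∈ Set.Icc (-1 : ℝ) 1) (hmean : ∀ i t, ∫ ω, R i t ω ∂P = μ i)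
    (t : ℕ) (π' π : Finset (Fin n)) :
    ∫ ω, signedIndicator π' π (I t ω) * R (I t ω) t ω ∂P
      = 1 / n * (setMean μ π' - setMean μ π) := by
  classical
  have hRint : ∀ i, Integrable (R i t) P := fun i => by
    refine Integrable.of_bound (hS.measurable_outcome i t).aestronglyMeasurable 1 ?_
    filter_upwards [hR i t] with ω hω
    exact abs_le.2 hω
  have hind : ∀ i, Measurable fun j : Fin n => if j = i then signedIndicator π' π i else 0 :=
    fun i => measurable_of_finite _
  have h1 : ∀ i, ∫ ω, (if I t ω = i then signedIndicator π' π i else 0) * R i t ω ∂P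
      = 1 / n * (signedIndicator π' π i * μ i) := by
    intro i
    have h2 : IndepFun (fun ω => if I t ω = i then signedIndicator π' π i else 0) (R i t) P :=
      (hS.indep_draw t).comp (hind i) (measurable_pi_apply i)
    rw [h2.integral_fun_mul_eq_mul_integral
      ((hind i).comp (hS.measurable_draw t)).aestronglyMeasurable
      (hS.measurable_outcome i t).aestronglyMeasurable, hmean,
      hS.integral_draw t fun j => if j = i then signedIndicator π' π i else 0]
    simp
    ring
  have h3 : ∀ ω, signedIndicator π' π (I t ω) * R (I t ω) t ω
      = ∑ i, (if I t ω = i then signedIndicator π' π i else 0) * R i t ω := by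
    intro ω
    simp
  simp only [h3]
  rw [integral_finsetSum, Finset.sum_congr rfl fun i _ => h1 i, ← Finset.mul_sum, ← setMean_sub]
  intro i _
  refine (hRint i).bdd_mul (c := 1)
    ((hind i).comp (hS.measurable_draw t)).aestronglyMeasurable
    (Filter.Eventually.of_forall fun ω => ?_)
  simp only [Real.norm_eq_abs]
  split_ifs
  · exact abs_signedIndicator_le _ _ _
  · simp

lemma bernsteinDraws (hS : StochasticSampling P I R)
    (hR : ∀ i t, ∀ᵐ ω ∂P, R i t ω ∈ Set.Icc (-1 : ℝ) 1) (hmean : ∀ i t, ∫ ω, R i t ω ∂P = μ i)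
    (t : ℕ) (π' π : Finset (Fin n)) : BernsteinDraws P I R μ t π' π where
  integrable l hl := by
    refine integrable_exp_of_abs_le (C := t)
      (measurable_drawnSum hS.measurable_draw hS.measurable_outcome t π' π) ?_ hl
    have hall : ∀ᵐ ω ∂P, ∀ i s, R i s ω ∈ Set.Icc (-1 : ℝ) 1 :=
      ae_all_iff.2 fun i => ae_all_iff.2 fun s => hR i s
    filter_upwards [hall] with ω hω
    exact abs_drawnSum_le (fun i s => abs_le.2 (hω i s)) t π' π
  mgf_le l hl hl3 := by
    set Z : ℕ → Ω → ℝ := fun s ω => signedIndicator π' π (I s ω) * R (I s ω) s ω with hZ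
    have hZm : ∀ s, Measurable (Z s) := fun s => (measurable_reward π' π).comp
      ((hS.measurable_draw s).prodMk (measurable_pi_iff.2 fun i => hS.measurable_outcome i s))
    have hZi : iIndepFun Z P := hS.indep_rounds.comp
      (fun _ x => signedIndicator π' π x.1 * x.2 x.1) fun _ => measurable_reward π' π
    have hsum : (fun ω => drawnSum (fun s => I s ω) (fun i s => R i s ω) t π' π)
        = ∑ s ∈ Finset.range t, Z s := by
      ext ω
      simp [drawnSum, hZ]
    set c := l ^ 2 / (2 * (1 - l / 3))
    have hc : 0 ≤ c := div_nonneg (sq_nonneg _) (by linarith)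
    have hone : ∀ s, mgf (Z s) P l
        ≤ 1 + l * (1 / n * (setMean μ π' - setMean μ π)) + symmDist π' π / n * c := by
      intro s
      have hRs : ∀ᵐ ω ∂P, ∀ i, |R i s ω| ≤ 1 := ae_all_iff.2 fun i => by
        filter_upwards [hR i s] with ω hω
        exact abs_le.2 hω
      have hZb : ∀ᵐ ω ∂P, |Z s ω| ≤ 1 := by
        filter_upwards [hRs] with ω hω
        rw [hZ, abs_mul]
        exact mul_le_one₀ (abs_signedIndicator_le _ _ _) (abs_nonneg _) (hω _)
      have hZint : Integrable (Z s) P := Integrable.of_bound (hZm s).aestronglyMeasurable 1 hZb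
      have hqint : Integrable (fun ω => signedIndicator π' π (I s ω) ^ 2 * c) P := by
        refine Integrable.of_bound ((measurable_of_finite fun i =>
          signedIndicator π' π i ^ 2 * c).comp (hS.measurable_draw s)).aestronglyMeasurable c
          (Filter.Eventually.of_forall fun ω => ?_)
        rw [Real.norm_of_nonneg (by positivity), ← sq_abs]
        exact mul_le_of_le_one_left hc (pow_le_one₀ (abs_nonneg _) (abs_signedIndicator_le _ _ _))
      have hlint : Integrable (fun ω => 1 + l * Z s ω) P :=
        (integrable_const _).add (hZint.const_mul l)
      have hle : mgf (Z s) P l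
          ≤ ∫ ω, (1 + l * Z s ω + signedIndicator π' π (I s ω) ^ 2 * c) ∂P := by
        refine integral_mono_ae (integrable_exp_of_abs_le (hZm s) hZb hl)
          (hlint.add hqint) ?_
        filter_upwards [hZb, hRs] with ω h1 h2
        refine (exp_mul_le_quadratic h1 hl hl3).trans ?_
        have h3 : Z s ω ^ 2 ≤ signedIndicator π' π (I s ω) ^ 2 := by
          rw [hZ, mul_pow]
          refine mul_le_of_le_one_right (sq_nonneg _) ?_
          rw [← sq_abs]
          exact pow_le_one₀ (abs_nonneg _) (h2 _)
        gcongr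
      refine hle.trans_eq ?_
      rw [integral_add hlint hqint,
        integral_add (integrable_const _) (hZint.const_mul l), integral_const_mul,
        hS.integral_reward hR hmean, integral_mul_const,
        hS.integral_draw s fun i => signedIndicator π' π i ^ 2, sum_signedIndicator_sq]
      simp only [integral_const, probReal_univ, smul_eq_mul]
      ring
    rw [hsum, hZi.mgf_sum hZm]
    refine (Finset.prod_le_prod (fun s _ => mgf_nonneg) fun s _ => hone s).trans ?_
    rw [Finset.prod_const, Finset.card_range]
    exact pow_mean_le_exp rfl (mgf_nonneg.trans (hone 0)) le_rfl

lemma pos (_ : StochasticSampling P I R) : 0 < n := by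
  obtain ⟨ω⟩ := nonempty_of_isProbabilityMeasure P
  exact (I 0 ω).pos

end StochasticSampling

/-! ### Classification -/

/-- Up to the factor `1 / n`, the risk is `∑ i, η i` minus the mean of `π` under `2 η - 1`. -/
lemma setMean_lt_of_risk_lt {η : Fin n → ℝ} {π π' : Finset (Fin n)}
    (h : risk η π' < risk η π) :
    setMean (fun i => 2 * η i - 1) π < setMean (fun i => 2 * η i - 1) π' := by
  have key : ∀ π : Finset (Fin n), ∑ i ∈ πᶜ, η i + ∑ i ∈ π, (1 - η i)
      = ∑ i, η i - setMean (fun i => 2 * η i - 1) π := by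
    intro π
    rw [← Finset.sum_add_sum_compl π η, setMean]
    simp only [Finset.sum_sub_distrib, ← Finset.mul_sum]
    ring
  rw [risk, risk, key, key] at h
  have := lt_of_mul_lt_mul_left h (by positivity)
  linarith

lemma StochasticSampling.rewards {Ω : Type*} [MeasurableSpace Ω] {P : Measure Ω}
    {I : ℕ → Ω → Fin n} {Y : Fin n → ℕ → Ω → ℝ} (hS : StochasticSampling P I Y) :
    StochasticSampling P I fun i t ω => 2 * Y i t ω - 1 where
  measurable_draw := hS.measurable_draw
  measurable_outcome i t := ((hS.measurable_outcome i t).const_mul 2).sub_const 1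
  uniform := hS.uniform
  identDistrib i t := (hS.identDistrib i t).comp
    (u := fun y : ℝ => 2 * y - 1) ((measurable_id.const_mul 2).sub_const 1)
  indep_rounds := hS.indep_rounds.comp (fun _ x => (x.1, fun i => 2 * x.2 i - 1)) fun _ =>
    measurable_fst.prodMk (measurable_pi_iff.2 fun i =>
      (((measurable_pi_apply i).comp measurable_snd).const_mul 2).sub_const 1)
  indep_draw t := (hS.indep_draw t).comp measurable_id
    (measurable_pi_iff.2 fun i => ((measurable_pi_apply i).const_mul 2).sub_const 1)

lemma integral_eq_measureReal_of_zero_or_one {Ω : Type*} [MeasurableSpace Ω] {P : Measure Ω}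
    {Y : Ω → ℝ} (hY : Measurable Y)
    (h : ∀ᵐ ω ∂P, Y ω = 0 ∨ Y ω = 1) : ∫ ω, Y ω ∂P = P.real {ω | Y ω = 1} := by
  rw [← integral_indicator_one (show MeasurableSet {ω | Y ω = 1} from
    hY (measurableSet_singleton 1))]
  refine integral_congr_ae ?_
  filter_upwards [h] with ω hω
  rcases hω with hω | hω <;> simp [Set.indicator, hω]

end

end ActionElimination

/-! ### The theorem -/

theorem theorem1 :
    ∃ c : ℝ, 0 < c ∧
      ∀ (n : ℕ) (F : Finset (Finset (Fin n))) (πs : Finset (Fin n)) (δ : ℝ),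
        πs ∈ F → 0 < δ → δ < 1 →
        -- pure-exploration combinatorial bandits
        (∀ μ : Fin n → ℝ, (∀ i, μ i ∈ Set.Icc (-1 : ℝ) 1) →
          (∀ π ∈ F, π ≠ πs → setMean μ π < setMean μ πs) →
          ∀ (Ω : Type u) [MeasurableSpace Ω] (P : Measure Ω) [IsProbabilityMeasure P]
            (I : ℕ → Ω → Fin n),
            (∀ R : Fin n → ℕ → Ω → ℝ, StochasticSampling P I R →
              (∀ i t, ∀ᵐ ω ∂P, R i t ω ∈ Set.Icc (-1 : ℝ) 1) →
              (∀ i t, ∫ ω, R i t ω ∂P = μ i) →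
              StochasticGuarantee c F πs μ δ P I R) ∧
            (SamplingWithoutReplacement P I → PersistentGuarantee c F πs μ δ P I)) ∧
        -- active classification, with `μ_i = 2 η_i - 1` and rewards `2 Y - 1`
        (∀ η : Fin n → ℝ, (∀ i, η i ∈ Set.Icc (0 : ℝ) 1) →
          (∀ π ∈ F, π ≠ πs → risk η πs < risk η π) →
          ∀ (Ω : Type u) [MeasurableSpace Ω] (P : Measure Ω) [IsProbabilityMeasure P]
            (I : ℕ → Ω → Fin n),
            (∀ Y : Fin n → ℕ → Ω → ℝ, StochasticSampling P I Y →
              (∀ i t, ∀ᵐ ω ∂P, Y i t ω = 0 ∨ Y i t ω = 1) →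
              (∀ i t, P.real {ω | Y i t ω = 1} = η i) →
              StochasticGuarantee c F πs (fun i => 2 * η i - 1) δ P I
                (fun i t ω => 2 * Y i t ω - 1)) ∧
            ((∀ i, η i = 0 ∨ η i = 1) → SamplingWithoutReplacement P I →
              PersistentGuarantee c F πs (fun i => 2 * η i - 1) δ P I)) := by
  refine ⟨5637, by norm_num, fun n F πs δ hs hδ hδ1 => ?_⟩
  have bandit : ∀ μ : Fin n → ℝ, (∀ i, μ i ∈ Set.Icc (-1 : ℝ) 1) →
      (∀ π ∈ F, π ≠ πs → setMean μ π < setMean μ πs) →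
      ∀ (Ω : Type u) [MeasurableSpace Ω] (P : Measure Ω) [IsProbabilityMeasure P]
        (I : ℕ → Ω → Fin n),
        (∀ R : Fin n → ℕ → Ω → ℝ, StochasticSampling P I R →
          (∀ i t, ∀ᵐ ω ∂P, R i t ω ∈ Set.Icc (-1 : ℝ) 1) →
          (∀ i t, ∫ ω, R i t ω ∂P = μ i) →
          StochasticGuarantee 5637 F πs μ δ P I R) ∧
        (SamplingWithoutReplacement P I → PersistentGuarantee 5637 F πs μ δ P I) := by
    intro μ hμ hbest Ω _ P _ I
    refine ⟨fun R hS hR hmean => ?_, fun hI => ?_⟩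
    · exact stochasticGuarantee_of_bernstein hμ hδ hδ1 hs hbest hS.pos hS.measurable_draw
        (fun T f => (hS.integral_prod_draws T f).le) (hS.bernsteinDraws hR hmean)
    · obtain ⟨ω⟩ := nonempty_of_isProbabilityMeasure P
      have hn : 0 < n := (I 0 ω).pos
      exact persistentGuarantee_of_bernstein hμ hδ hδ1 hs hbest hn hI
        fun t ht => hI.bernsteinDraws hμ hn ht
  refine ⟨bandit, fun η hη hbest Ω _ P _ I => ?_⟩
  have hμ : ∀ i, 2 * η i - 1 ∈ Set.Icc (-1 : ℝ) 1 := fun i =>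
    ⟨by linarith [(hη i).1], by linarith [(hη i).2]⟩
  -- Classification is the bandit problem with means `2 η - 1`; what remains is that the rewards `2
  -- Y - 1` are bounded by 1 and have these means.
  obtain ⟨h1, h2⟩ := bandit _ hμ (fun π hπ hne => setMean_lt_of_risk_lt (hbest π hπ hne)) Ω P I
  refine ⟨fun Y hS hY hmean => h1 _ hS.rewards (fun i t => ?_) (fun i t => ?_), fun _ => h2⟩
  · filter_upwards [hY i t] with ω hω
    rcases hω with hω | hω <;> rw [hω] <;> norm_num
  · have hint : Integrable (Y i t) P := by
      refine Integrable.of_bound (hS.measurable_outcome i t).aestronglyMeasurable 1 ?_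
      filter_upwards [hY i t] with ω hω
      rcases hω with hω | hω <;> simp [hω]
    rw [integral_sub (hint.const_mul 2) (integrable_const _), integral_const_mul,
      integral_eq_measureReal_of_zero_or_one (hS.measurable_outcome i t) (hY i t), hmean]
    simp
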